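/- **Setting and definitions.** Let $d,r\ge 1$ be integers, let $A,B$ be real symmetric $d\times d$ matrices with $B$ positive definite, let $\Lambda=\{x\in\mathbb R^d:\|x\|=1\}$ (Euclidean norm), let $C_r=\{x\in\mathbb R^d:\|x\|_0\le r\}$, where $\|x\|_0$ is the number of nonzero coordinates of $x$, and put $S=\Lambda\cap C_r$. Let $\delta_S$ be $0$ on $S$ and $+\infty$ elsewhere, and $$\Phi(x)=\frac{x^\top Ax}{x^\top Bx}+\delta_{S}(x),\qquad x\in\mathbb R^d .$$ For a function $f$ on a finite-dimensional real Hilbert space with values in $[-\infty,+\infty]$ and a point $x$ with $f(x)$ finite, the Fréchet subdifferential $\widehat\partial f(x)$ is the set of $u$ with $\liminf_{z\to x}\frac{f(z)-f(x)-\langle u,z-x\rangle}{\|z-x\|}\ge 0$, and the limiting subdifferential $\partial_Lf(x)$ is the set of limits of sequences $u_n\in\widehat\partial f(x_n)$ with $x_n\to x$ and $f(x_n)\to f(x)$; $\operatorname{dom}\partial_L f=\{x:\partial_L f(x)\ne\varnothing\}$. A proper lower semicontinuous $f$ has the KL property at $\bar x\in\operatorname{dom}\partial_L f$ if there are a neighbourhood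 $U$ of $\bar x$, $\eta\in(0,+\infty]$ and a continuous concave $\varphi:[0,\eta)\to[0,+\infty)$ with $\varphi(0)=0$, continuously differentiable with $\varphi'>0$ on $(0,\eta)$, such that $\varphi'(f(x)-f(\bar x))\operatorname{dist}(0,\partial_Lf(x))\ge 1$ for all $x\in U$ with $f(\bar x)<f(x)<f(\bar x)+\eta$ (where $\operatorname{dist}(0,\varnothing)=+\infty$). It has the KL property at $\bar x$ with exponent $\alpha\in[0,1)$ if one can take $\varphi(s)=\gamma s^{1-\alpha}$ for some $\gamma>0$. It is a KL function (with exponent $\alpha$) if it has the KL property (with exponent $\alpha$) at every point of $\operatorname{dom}\partial_Lf$. **Theorem.** 1. $\Phi$ is a KL function with exponent $\tfrac12$. 2. For all $\rho\ge 0$ and all $\bar x\in\operatorname{dom}\partial_L\Phi$, the function $\widehat\Phi(x,u)=\Phi(x)+\rho\|x-u\|^2$ on $\mathbb R^d\times\mathbb R^d$ has the KL property with exponent $\tfrac12$ at $(\bar x,\bar x)$. 3. Suppose that $-A$ is positive semidefinite, and let $f(x)=-x^\top Ax$, $g(x)=x^\top Bx$ and $F=f/g$. Let $\alpha,\beta\ge0$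 be such that, for all $x,z\in S$: $\left\langle \frac{u}{2\sqrt{f(x)}},z-x\right\rangle\le\sqrt{f(z)}-\sqrt{f(x)}+\frac\alpha2\|z-x\|^2$ for all $u\in\partial_Lf(x)$ whenever $f(x)>0$, and $\langle v,z-x\rangle\ge g(z)-g(x)-\frac\beta2\|z-x\|^2$ for all $v\in\partial_Lg(x)$. Let $\delta>0$ and $\bar\nu\in[0,\delta/2)$, and let $(x_n)_{n\ge0}$ be generated by the inertial proximal subgradient method for maximizing $F$ over $S$: $x_{-1}=x_0\in S$ and, for each $n\ge 0$, with $y_n=\sqrt{f(x_n)}/g(x_n)$, some $\tau_n\ge\delta+\frac12(2y_n\alpha+y_n^2\beta)$, some $\nu_n\in[0,\bar\nu/\tau_n]$, $z_n=x_n+\nu_n(x_n-x_{n-1})$, some $u_n\in\partial_Lf(x_n)$ and $v_n\in\partial_Lg(x_n)$, and $w_n=\frac{y_n}{\sqrt{f(x_n)}}u_n-y_n^2v_n$ if $f(x_n)>0$, $w_n=0$ if $f(x_n)=0$, $$x_{n+1}\in\operatorname*{argmax}_{x\in S}\left\{-\tau_n\left\|x-z_n-\tfrac1{2\tau_n}w_n\right\|^2\right\}.$$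 If $\limsup_n\tau_n<+\infty$, then $\sum_{n}\|x_{n+1}-x_n\|<+\infty$, the sequence $(x_n)$ converges to a point $x^*\in S$ with $0\in\partial_L\Phi(x^*)$, and the convergence is linear: there are $\gamma>0$ and $q\in(0,1)$ such that, for all $n\ge 0$, $\|x_n-x^*\|\le\gamma q^{n/2}$ and $|F(x_n)-F(x^*)|\le\gamma q^n$. -/

import Mathlib

open Filter Topology
open scoped Matrix ENNReal

noncomputable section

namespace SparseGEP

/-! ### Variational analysis: indicator functions, subdifferentials, the KL property -/

section Variational

variable {H : Type*} [NormedAddCommGroup H] [InnerProductSpace ℝ H]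

open Classical in
/-- The indicator function `δ_C`: `0` on `C` and `+∞` off `C`. -/
def indicatorFun {X : Type*} (C : Set X) (x : X) : EReal := if x ∈ C then 0 else ⊤

/-- A function `f : X → [-∞, +∞]` is proper if it never equals `-∞` and is not identically `+∞`. -/
def IsProper {X : Type*} (f : X → EReal) : Prop :=
  (∃ x, f x < ⊤) ∧ ∀ x, f x ≠ ⊥

/-- The Fréchet subdifferential of `f` at `x` (empty where `f x` is not finite). -/
def frechetSubdiff (f : H → EReal) (x : H) : Set H :=
  {u | f x ≠ ⊤ ∧ f x ≠ ⊥ ∧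
    0 ≤ liminf (fun z => (f z - f x - ((inner ℝ u (z - x) : ℝ) : EReal)) / ((‖z - x‖ : ℝ) : EReal))
      (𝓝[≠] x)}

/-- The limiting subdifferential `∂_L f` of `f` at `x` (empty where `f x` is not finite). -/
def limitingSubdiff (f : H → EReal) (x : H) : Set H :=
  {u | f x ≠ ⊤ ∧ f x ≠ ⊥ ∧
    ∃ (y : ℕ → H) (v : ℕ → H),
      Tendsto y atTop (𝓝 x) ∧ Tendsto (fun n => f (y n)) atTop (𝓝 (f x)) ∧
      Tendsto v atTop (𝓝 u) ∧ ∀ n, v n ∈ frechetSubdiff f (y n)}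

/-- The domain of the limiting subdifferential. -/
def subdiffDomain (f : H → EReal) : Set H := {x | (limitingSubdiff f x).Nonempty}

/-- `φ` is a desingularization function on `[0, η)`, where `η ∈ (0, +∞]`. -/
structure IsDesingularizing (η : EReal) (φ : ℝ → ℝ) : Prop where
  pos : 0 < η
  continuousOn : ContinuousOn φ {s : ℝ | 0 ≤ s ∧ (s : EReal) < η}
  concaveOn : ConcaveOn ℝ {s : ℝ | 0 ≤ s ∧ (s : EReal) < η} φ
  nonneg : ∀ s : ℝ, 0 ≤ s → (s : EReal) < η → 0 ≤ φ s
  map_zero : φ 0 = 0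
  differentiableAt : ∀ s : ℝ, 0 < s → (s : EReal) < η → DifferentiableAt ℝ φ s
  continuousOn_deriv : ContinuousOn (deriv φ) {s : ℝ | 0 < s ∧ (s : EReal) < η}
  deriv_pos : ∀ s : ℝ, 0 < s → (s : EReal) < η → 0 < deriv φ s

/-- `f` is proper and lower semicontinuous, `xbar ∈ dom ∂_L f`, and the KL inequality
`φ'(f x - f xbar) * dist(0, ∂_L f x) ≥ 1` holds near `xbar`, for the given function `φ`.
The distance is extended-valued, so that the distance to the empty set is `+∞`. -/
def HasKLPropertyWith (f : H → EReal) (xbar : H) (φ : ℝ → ℝ) : Prop :=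
  IsProper f ∧ LowerSemicontinuous f ∧ xbar ∈ subdiffDomain f ∧
    ∃ U ∈ 𝓝 xbar, ∃ η : EReal, IsDesingularizing η φ ∧
      ∀ x ∈ U, f xbar < f x → f x < f xbar + η →
        1 ≤ ENNReal.ofReal (deriv φ (f x - f xbar).toReal) *
          Metric.infEDist (0 : H) (limitingSubdiff f x)

/-- The KL property of `f` at `xbar`. -/
def HasKLProperty (f : H → EReal) (xbar : H) : Prop :=
  ∃ φ : ℝ → ℝ, HasKLPropertyWith f xbar φ

/-- The KL property of `f` at `xbar` with exponent `a ∈ [0, 1)`: the desingularization function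
can be chosen as `s ↦ γ s ^ (1 - a)` with `γ > 0`. -/
def HasKLPropertyWithExponent (f : H → EReal) (xbar : H) (a : ℝ) : Prop :=
  0 ≤ a ∧ a < 1 ∧ ∃ γ : ℝ, 0 < γ ∧ HasKLPropertyWith f xbar (fun s => γ * s ^ (1 - a))

/-- A KL function. -/
def IsKLFunction (f : H → EReal) : Prop :=
  IsProper f ∧ LowerSemicontinuous f ∧ ∀ xbar ∈ subdiffDomain f, HasKLProperty f xbar

/-- A KL function with exponent `a`. -/
def IsKLFunctionWithExponent (f : H → EReal) (a : ℝ) : Prop :=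
  IsKLFunction f ∧ ∀ xbar ∈ subdiffDomain f, HasKLPropertyWithExponent f xbar a

/-! ### The inertial proximal subgradient method for one ratio

The problem is to maximize `f x / g x` over `x ∈ S`. -/

/-- `α ≥ 0` is a weak convexity constant on `S` for the square root of the numerator `f`. -/
def IsNumeratorConstant (f : H → ℝ) (S : Set H) (α : ℝ) : Prop :=
  0 ≤ α ∧ ∀ x ∈ S, ∀ z ∈ S, ∀ u ∈ limitingSubdiff (fun p => (f p : EReal)) x, 0 < f x →
    inner ℝ ((1 / (2 * √(f x))) • u) (z - x) ≤ √(f z) - √(f x) + α / 2 * ‖z - x‖ ^ 2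

/-- `β ≥ 0` is a descent-lemma constant on `S` for the denominator `g`. -/
def IsDenominatorConstant (g : H → ℝ) (S : Set H) (β : ℝ) : Prop :=
  0 ≤ β ∧ ∀ x ∈ S, ∀ z ∈ S, ∀ v ∈ limitingSubdiff (fun p => (g p : EReal)) x,
    inner ℝ v (z - x) ≥ g z - g x - β / 2 * ‖z - x‖ ^ 2

/-- One step of the method: from the previous iterate `xprev` and the current iterate `x` to the
next iterate `xnext`, with parameters `τ` and `ν`. -/
def IsInertialProxStep (f g : H → ℝ) (S : Set H) (α β δ νbar τ ν : ℝ) (xprev x xnext : H) : Prop :=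
  ∃ u ∈ limitingSubdiff (fun p => (f p : EReal)) x,
  ∃ v ∈ limitingSubdiff (fun p => (g p : EReal)) x,
  ∃ (y : ℝ) (z w : H),
    y = √(f x) / g x ∧
    δ + (2 * y * α + y ^ 2 * β) / 2 ≤ τ ∧
    0 ≤ ν ∧ ν ≤ νbar / τ ∧
    z = x + ν • (x - xprev) ∧
    w = (if 0 < f x then (y / √(f x)) • u - (y ^ 2) • v else 0) ∧
    xnext ∈ S ∧ IsMaxOn (fun p => -(τ * ‖p - z - (1 / (2 * τ)) • w‖ ^ 2)) S xnext

/-- `x` is a sequence generated by the method, started at `x 0 ∈ S` with `x (-1) = x 0`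
(for `n = 0` the truncated `n - 1` is `0`, as required). -/
def IsInertialProxSequence (f g : H → ℝ) (S : Set H) (α β δ νbar : ℝ) (τ ν : ℕ → ℝ)
    (x : ℕ → H) : Prop :=
  0 < δ ∧ 0 ≤ νbar ∧ νbar < δ / 2 ∧ x 0 ∈ S ∧
    ∀ n, IsInertialProxStep f g S α β δ νbar (τ n) (ν n) (x (n - 1)) (x n) (x (n + 1))

end Variational

/-! ### The sparsity-constrained generalized eigenvalue problem -/

variable {d : ℕ}

/-- The quadratic form `xᵀ M x`. -/
def quadForm (M : Matrix (Fin d) (Fin d) ℝ) (x : EuclideanSpace ℝ (Fin d)) : ℝ :=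
  x.ofLp ⬝ᵥ (M *ᵥ x.ofLp)

/-- The Euclidean unit sphere `Λ` of `ℝ^d`. -/
def unitSphere (d : ℕ) : Set (EuclideanSpace ℝ (Fin d)) := {x | ‖x‖ = 1}

/-- `C_r`, the vectors with at most `r` nonzero coordinates. -/
def sparseSet (d r : ℕ) : Set (EuclideanSpace ℝ (Fin d)) := {x | hammingNorm x.ofLp ≤ r}

/-- `Φ(x) = xᵀ A x / xᵀ B x + δ_{Λ ∩ C_r}(x)`. -/
def Phi (A B : Matrix (Fin d) (Fin d) ℝ) (r : ℕ) (x : EuclideanSpace ℝ (Fin d)) : EReal :=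
  ((quadForm A x / quadForm B x : ℝ) : EReal) + indicatorFun (unitSphere d ∩ sparseSet d r) x

/-- The merit function `(x, u) ↦ Φ(x) + ρ ‖x - u‖²` on the Hilbert space `ℝ^d × ℝ^d`. -/
def meritPhi (A B : Matrix (Fin d) (Fin d) ℝ) (r : ℕ) (ρ : ℝ)
    (z : WithLp 2 (EuclideanSpace ℝ (Fin d) × EuclideanSpace ℝ (Fin d))) : EReal :=
  Phi A B r z.fst + ((ρ * ‖z.fst - z.snd‖ ^ 2 : ℝ) : EReal)

end SparseGEP

end

/-! The constraint set `S` is the set of unit vectors in a finite union of coordinate subspaces, one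
for each support of size at most `r`. On one such subspace with orthogonal projection `P`, write `R`
for the quotient, `μ` for any real level and `s = R x - μ`. The operator `N = P (a - μ b) P` is
symmetric, `⟨x, N x⟩ = s ⟨x, b x⟩`, and in finite dimension `|⟨x, N x⟩| ≤ C ‖N x‖²`. Since the
projected gradient of `R` is a positive multiple of `N x - s P b x`, the bound `c |s| ≤ ‖P ∇R x‖²`
follows once `|s|` is small. A Fréchet subgradient of `Φ` at `x` has norm at least `‖P ∇R x‖`, as
seen by testing it along curves in the sphere of the subspace. This quadratic bound is the KL
inequality with exponent 1/2; the merit function is treated by testing pairs of curves.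

For the algorithm, the proximal step yields sufficient decrease of `R (x n) + (δ/2) ‖x n - x
(n-1)‖²` and a Fréchet subgradient at the new iterate bounded by the last two steps. The quadratic
bound needs only values close to `μ`, so it applies at the limit of the values before the iterates
are known to converge. Decrease and error bound then give geometric decay directly. -/

noncomputable section

namespace SparseGEP

/-! ### Fréchet and limiting subgradients; a criterion for KL exponent 1/2 -/

section Subdifferentials

variable {H : Type*} [NormedAddCommGroup H] [InnerProductSpace ℝ H]

/-- Together with its converse below, this trades the extended-real liminf for real inequalities
with an arbitrary slope error `ε`, the only form used later. -/
theorem eventually_le_of_mem_frechetSubdiff {f : H → EReal} {x u : H} {m : ℝ}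
    (hu : u ∈ frechetSubdiff f x) (hm : f x = m) {ε : ℝ} (hε : 0 < ε) :
    ∀ᶠ z in 𝓝 x, ((m + inner ℝ u (z - x) - ε * ‖z - x‖ : ℝ) : EReal) ≤ f z := by
  obtain ⟨-, -, h⟩ := hu
  have h1 : ((-ε : ℝ) : EReal) < liminf (fun z => (f z - f x - ((inner ℝ u (z - x) : ℝ) : EReal)) /
      ((‖z - x‖ : ℝ) : EReal)) (𝓝[≠] x) :=
    lt_of_lt_of_le (by exact_mod_cast neg_neg_of_pos hε) h
  have h2 := eventually_nhdsWithin_iff.1 (eventually_lt_of_lt_liminf h1)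
  filter_upwards [h2] with z hz
  by_cases hzx : z = x
  · subst hzx; simp [hm]
  have hz := hz hzx
  have hn : 0 < ‖z - x‖ := norm_pos_iff.2 (sub_ne_zero.2 hzx)
  rw [hm] at hz
  induction hfz : f z using EReal.rec with
  | bot =>
    rw [hfz, EReal.bot_sub, EReal.bot_sub, EReal.bot_div_of_pos_ne_top (by exact_mod_cast hn)
      (EReal.coe_ne_top _)] at hz
    exact absurd hz not_lt_bot
  | top => exact le_top
  | coe y =>
    rw [hfz] at hz
    rw [← EReal.coe_sub, ← EReal.coe_sub, ← EReal.coe_div, EReal.coe_lt_coe_iff,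
      lt_div_iff₀ hn] at hz
    rw [EReal.coe_le_coe_iff]
    linarith

theorem mem_frechetSubdiff_of_eventually_le {f : H → EReal} {x u : H} {m : ℝ} (hm : f x = m)
    (h : ∀ ε : ℝ, 0 < ε →
      ∀ᶠ z in 𝓝 x, ((m + inner ℝ u (z - x) - ε * ‖z - x‖ : ℝ) : EReal) ≤ f z) :
    u ∈ frechetSubdiff f x := by
  refine ⟨by simp [hm], by simp [hm], ?_⟩
  refine le_of_forall_lt fun c hc => ?_
  obtain ⟨e, he1, he2⟩ := EReal.lt_iff_exists_real_btwn.1 hc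
  refine lt_of_lt_of_le he1 (le_liminf_of_le (by isBoundedDefault) ?_)
  have he : 0 < -e := by
    have : e < 0 := by exact_mod_cast he2
    linarith
  refine eventually_nhdsWithin_iff.2 ?_
  filter_upwards [h (-e) he] with z hz hzx
  have hn : 0 < ‖z - x‖ := norm_pos_iff.2 (sub_ne_zero.2 hzx)
  rw [hm]
  induction hfz : f z using EReal.rec with
  | bot => rw [hfz] at hz; exact absurd (le_bot_iff.1 hz) (EReal.coe_ne_bot _)
  | top =>
    rw [EReal.top_sub_coe, EReal.top_sub_coe, EReal.top_div_of_pos_ne_top (by exact_mod_cast hn)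
      (EReal.coe_ne_top _)]
    exact le_top
  | coe y =>
    rw [hfz] at hz
    rw [EReal.coe_le_coe_iff] at hz
    rw [← EReal.coe_sub, ← EReal.coe_sub, ← EReal.coe_div, EReal.coe_le_coe_iff, le_div_iff₀ hn]
    linarith

/-- A Fréchet subgradient is dominated by the derivative of the function along curves. -/
theorem inner_le_of_mem_frechetSubdiff {f : H → EReal} {x u h : H} (hu : u ∈ frechetSubdiff f x)
    {c : ℝ → H} {φ : ℝ → ℝ} {φ' : ℝ} (hc : HasDerivAt c h 0) (hc0 : c 0 = x)
    (hφ : HasDerivAt φ φ' 0) (hf : ∀ t, f (c t) = φ t) : inner ℝ u h ≤ φ' := by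
  refine le_of_forall_pos_le_add fun ε hε => ?_
  -- Chosen so that `e * ‖h‖ ≤ ε`, also when `h = 0`.
  set e := ε / (‖h‖ + 1) with he
  have hh : 0 < ‖h‖ + 1 := by positivity
  have he0 : 0 < e := div_pos hε hh
  have hfx : f x = φ 0 := by rw [← hc0, hf]
  have hev : ∀ᶠ t in 𝓝 (0 : ℝ), φ 0 + inner ℝ u (c t - x) - e * ‖c t - x‖ ≤ φ t := by
    have := hc.continuousAt.tendsto
    rw [hc0] at this
    filter_upwards [this.eventually (eventually_le_of_mem_frechetSubdiff hu hfx he0)] with t ht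
    rw [hf] at ht
    exact_mod_cast ht
  have t1 : Tendsto (fun t : ℝ => t⁻¹ • (c t - x)) (𝓝[>] 0) (𝓝 h) := by
    have := (hasDerivAt_iff_tendsto_slope_zero.1 hc).mono_left
      (nhdsWithin_mono 0 fun t (ht : t ∈ Set.Ioi 0) => (Set.mem_Ioi.1 ht).ne')
    simpa [hc0] using this
  have t2 : Tendsto (fun t : ℝ => t⁻¹ * (φ t - φ 0)) (𝓝[>] 0) (𝓝 φ') := by
    have := (hasDerivAt_iff_tendsto_slope_zero.1 hφ).mono_left
      (nhdsWithin_mono 0 fun t (ht : t ∈ Set.Ioi 0) => (Set.mem_Ioi.1 ht).ne')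
    simpa using this
  have t3 : Tendsto (fun t : ℝ => inner ℝ u (t⁻¹ • (c t - x)) - e * ‖t⁻¹ • (c t - x)‖) (𝓝[>] 0)
      (𝓝 (inner ℝ u h - e * ‖h‖)) :=
    (tendsto_const_nhds.inner t1).sub (t1.norm.const_mul e)
  have key := le_of_tendsto_of_tendsto t3 t2 (by
    filter_upwards [hev.filter_mono nhdsWithin_le_nhds, self_mem_nhdsWithin] with t ht htpos
    have htp : (0 : ℝ) < t := htpos
    rw [norm_smul, real_inner_smul_right, Real.norm_of_nonneg (inv_pos.2 htp).le]
    have := mul_le_mul_of_nonneg_left ht (inv_pos.2 htp).le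
    linarith)
  have : e * ‖h‖ ≤ ε := by
    rw [he, div_mul_eq_mul_div, div_le_iff₀ hh]
    nlinarith [norm_nonneg h]
  linarith

theorem hasDerivAt_add_smul (x h : H) : HasDerivAt (fun t : ℝ => x + t • h) h 0 := by
  simpa using ((hasDerivAt_id (0 : ℝ)).smul_const h).const_add x

/-- Testing along straight lines gives `⟨u, h⟩ ≤ ⟨g, h⟩` for every `h`; the choice `h = u - g`
forces equality. -/
theorem frechetSubdiff_coe_subset {f : H → ℝ} {x g : H} [CompleteSpace H]
    (hf : HasGradientAt f g x) : frechetSubdiff (fun p => (f p : EReal)) x ⊆ {g} := by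
  intro u hu
  have key : ∀ h : H, inner ℝ u h ≤ inner ℝ g h := by
    intro h
    have hc := hasDerivAt_add_smul x h
    refine inner_le_of_mem_frechetSubdiff hu hc (by simp) (φ := fun t => f (x + t • h)) ?_
      (fun t => rfl)
    have h1 : HasFDerivAt f (InnerProductSpace.toDual ℝ H g) (x + (0 : ℝ) • h) := by
      simpa using hf.hasFDerivAt
    exact h1.comp_hasDerivAt (0 : ℝ) hc
  have h2 := key (u - g)
  have : inner ℝ (u - g) (u - g) ≤ (0 : ℝ) := by rw [inner_sub_left]; linarith
  exact sub_eq_zero.1 (real_inner_self_nonpos.1 this)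

/-- This identifies the subgradients picked by the algorithm with ordinary gradients. -/
theorem limitingSubdiff_coe_subset [CompleteSpace H] {f : H → ℝ} {g : H → H}
    (hf : ∀ x, HasGradientAt f (g x) x) (hg : Continuous g) (x : H) :
    limitingSubdiff (fun p => (f p : EReal)) x ⊆ {g x} := by
  rintro u ⟨-, -, y, v, hy, -, hv, hyv⟩
  have : v = fun n => g (y n) := funext fun n => frechetSubdiff_coe_subset (hf _) (hyv n)
  rw [this] at hv
  exact tendsto_nhds_unique hv ((hg.tendsto x).comp hy)

/-- The function `s ↦ γ √s` is a desingularization function on `[0, ∞)`. -/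
theorem isDesingularizing_sqrt {γ : ℝ} (hγ : 0 < γ) :
    IsDesingularizing ⊤ (fun s : ℝ => γ * s ^ (1 - 1 / 2 : ℝ)) := by
  have hexp : (1 - 1 / 2 : ℝ) = 1 / 2 := by norm_num
  have hset : {s : ℝ | 0 ≤ s ∧ (s : EReal) < ⊤} = Set.Ici 0 := by
    ext s; simp [EReal.coe_lt_top]
  have hder : ∀ s : ℝ, 0 < s → HasDerivAt (fun s : ℝ => γ * s ^ (1 - 1 / 2 : ℝ))
      (γ * ((1 - 1 / 2) * s ^ ((1 - 1 / 2 : ℝ) - 1))) s := fun s hs =>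
    (Real.hasDerivAt_rpow_const (Or.inl hs.ne')).const_mul γ
  refine ⟨by simp, ?_, ?_, ?_, ?_, ?_, ?_, ?_⟩
  · exact (continuous_const.mul (Real.continuous_rpow_const (by norm_num))).continuousOn
  · rw [hset]
    have := (Real.concaveOn_rpow (p := (1 - 1 / 2 : ℝ)) (by norm_num) (by norm_num)).smul hγ.le
    simpa using this
  · intro s hs _
    positivity
  · rw [hexp, Real.zero_rpow (by norm_num), mul_zero]
  · exact fun s hs _ => (hder s hs).differentiableAt
  · have : ContinuousOn (fun s : ℝ => γ * ((1 - 1 / 2) * s ^ ((1 - 1 / 2 : ℝ) - 1)))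
        {s : ℝ | 0 < s ∧ (s : EReal) < ⊤} := by
      intro s hs
      refine ContinuousAt.continuousWithinAt ?_
      exact (((Real.continuousAt_rpow_const s _ (Or.inl hs.1.ne')).const_mul _).const_mul _)
    exact this.congr fun s hs => (hder s hs.1).deriv
  · intro s hs _
    rw [(hder s hs).deriv]
    have := Real.rpow_pos_of_pos hs ((1 - 1 / 2 : ℝ) - 1)
    positivity

/-- The KL property with exponent `1/2` follows from a quadratic estimate for Fréchet
subgradients. -/
theorem hasKLPropertyWithExponent_half {f : H → EReal} (hp : IsProper f)
    (hl : LowerSemicontinuous f) {xbar : H} (hx : xbar ∈ subdiffDomain f) {m : ℝ}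
    (hm : f xbar = m) {c : ℝ} (hc : 0 < c)
    (h : ∀ᶠ x in 𝓝 xbar, ∀ v ∈ frechetSubdiff f x, c * ((f x).toReal - m) ≤ ‖v‖ ^ 2) :
    HasKLPropertyWithExponent f xbar (1 / 2) := by
  -- With this factor `φ' s = 1 / (√c √s)`, so the KL inequality says that the distance is at least
  -- `√(c s)`.
  refine ⟨by norm_num, by norm_num, 2 / √c, by positivity, hp, hl, hx, ?_⟩
  obtain ⟨U, hU, hUo, hxU⟩ := eventually_nhds_iff.1 h
  refine ⟨U, hUo.mem_nhds hxU, ⊤, isDesingularizing_sqrt (by positivity), ?_⟩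
  intro x hxU' hlt hlt2
  -- The distance is then `⊤`, and the product is `⊤` because `φ' > 0` (in `ℝ≥0∞`, `0 * ⊤ = 0`).
  by_cases hne : limitingSubdiff f x = ∅
  · rw [hne, Metric.infEDist_empty]
    have hxtop : f x < ⊤ := lt_of_lt_of_le hlt2 le_top
    lift f x to ℝ using ⟨hxtop.ne, hp.2 x⟩ with y hy
    rw [hm] at hlt ⊢
    have hs : (0 : ℝ) < ((y : EReal) - (m : EReal)).toReal := by
      rw [← EReal.coe_sub, EReal.toReal_coe]
      have : m < y := by exact_mod_cast hlt
      linarith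
    have := (isDesingularizing_sqrt (γ := 2 / √c) (by positivity)).deriv_pos _ hs
      (EReal.coe_lt_top _)
    rw [ENNReal.mul_top (by simpa using this)]
    exact le_top
  obtain ⟨u0, hu0⟩ := Set.nonempty_iff_ne_empty.2 hne
  obtain ⟨y, hy⟩ : ∃ y : ℝ, f x = y := ⟨(f x).toReal, (EReal.coe_toReal hu0.1 hu0.2.1).symm⟩
  rw [hm, hy] at hlt ⊢
  have hs : 0 < y - m := by
    have : m < y := by exact_mod_cast hlt
    linarith
  have hsub : ((y : EReal) - (m : EReal)).toReal = y - m := by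
    rw [← EReal.coe_sub, EReal.toReal_coe]
  rw [hsub]
  have hder : deriv (fun s : ℝ => 2 / √c * s ^ (1 - 1 / 2 : ℝ)) (y - m) =
      1 / (√c * √(y - m)) := by
    rw [((Real.hasDerivAt_rpow_const (p := (1 - 1 / 2 : ℝ)) (Or.inl hs.ne')).const_mul
      (2 / √c)).deriv]
    have : ((1 - 1 / 2 : ℝ) - 1) = -(1 / 2) := by norm_num
    rw [this, Real.rpow_neg hs.le, ← Real.sqrt_eq_rpow]
    field_simp
    norm_num
  rw [hder]
  have hdist : ENNReal.ofReal (√c * √(y - m)) ≤ Metric.infEDist 0 (limitingSubdiff f x) := by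
    rw [Metric.le_infEDist]
    rintro u ⟨-, -, z, v, hz, hfz, hv, hzv⟩
    rw [edist_dist, dist_zero_left]
    refine ENNReal.ofReal_le_ofReal ?_
    -- The bound passes from Fréchet to limiting subgradients because the function values converge
    -- along the defining sequence.
    have h1 : Tendsto (fun n => c * ((f (z n)).toReal - m)) atTop (𝓝 (c * (y - m))) := by
      rw [hy] at hfz
      have := (EReal.tendsto_toReal (EReal.coe_ne_top y) (EReal.coe_ne_bot y)).comp hfz
      exact (this.sub_const m).const_mul c
    have h2 : c * (y - m) ≤ ‖u‖ ^ 2 := by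
      refine le_of_tendsto_of_tendsto h1 (hv.norm.pow 2) ?_
      filter_upwards [hz.eventually (hUo.mem_nhds hxU')] with n hn
      exact hU _ hn _ (hzv n)
    rw [← Real.sqrt_mul hc.le]
    exact Real.sqrt_le_iff.2 ⟨norm_nonneg _, h2⟩
  have hpos : 0 < √c * √(y - m) := by positivity
  calc (1 : ℝ≥0∞) = ENNReal.ofReal (1 / (√c * √(y - m))) * ENNReal.ofReal (√c * √(y - m)) := by
        rw [← ENNReal.ofReal_mul (by positivity), one_div, inv_mul_cancel₀ hpos.ne',
          ENNReal.ofReal_one]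
    _ ≤ _ := by gcongr

end Subdifferentials

/-! ### The generalized Rayleigh quotient and its projected gradient -/

section Rayleigh

variable {E : Type*} [NormedAddCommGroup E] [InnerProductSpace ℝ E] {a b : E →L[ℝ] E}

/-- The generalized Rayleigh quotient `⟨x, a x⟩ / ⟨x, b x⟩`. -/
def rayleigh (a b : E →L[ℝ] E) (x : E) : ℝ := inner ℝ x (a x) / inner ℝ x (b x)

/-- The gradient of the generalized Rayleigh quotient of two symmetric operators. -/
def rayleighGrad (a b : E →L[ℝ] E) (x : E) : E :=
  (2 / inner ℝ x (b x) : ℝ) • (a x - rayleigh a b x • b x)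

theorem hasGradientAt_inner_self_apply [CompleteSpace E] (ha : a.IsSymmetric) (x : E) :
    HasGradientAt (fun x => inner ℝ x (a x)) ((2 : ℝ) • a x) x := by
  rw [hasGradientAt_iff_hasFDerivAt]
  refine ((hasFDerivAt_id x).inner ℝ a.hasFDerivAt).congr_fderiv ?_
  ext h
  have : inner ℝ x (a h) = (inner ℝ (a x) h : ℝ) := (ha x h).symm
  simp [fderivInnerCLM_apply, this, real_inner_comm h (a x), two_mul]

theorem hasGradientAt_rayleigh [CompleteSpace E] (ha : a.IsSymmetric) (hb : b.IsSymmetric) {x : E}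
    (hx : inner ℝ x (b x) ≠ 0) : HasGradientAt (rayleigh a b) (rayleighGrad a b x) x := by
  have h1 := (hasGradientAt_inner_self_apply ha x).hasFDerivAt
  have h2 := (hasGradientAt_inner_self_apply hb x).hasFDerivAt
  rw [hasGradientAt_iff_hasFDerivAt]
  have h3 := h1.mul ((hasDerivAt_inv hx).comp_hasFDerivAt x h2)
  refine (h3.congr_fderiv ?_).congr_of_eventuallyEq
    (Eventually.of_forall fun y => div_eq_mul_inv _ _)
  ext h
  simp only [rayleighGrad, rayleigh, map_smul, map_sub, InnerProductSpace.toDual_apply_apply,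
    smul_apply, add_apply, sub_apply, smul_eq_mul,
    Function.comp_apply]
  field_simp
  ring

/-- Euler's identity for a function homogeneous of degree zero; it makes the projected gradient
tangent to the sphere. -/
theorem inner_rayleighGrad_self {x : E} (hx : inner ℝ x (b x) ≠ 0) :
    inner ℝ (rayleighGrad a b x) x = 0 := by
  rw [rayleighGrad, rayleigh, real_inner_smul_left, inner_sub_left, real_inner_smul_left,
    real_inner_comm x, real_inner_comm x, div_mul_cancel₀ _ hx, sub_self, mul_zero]

theorem continuousAt_rayleigh {x : E} (hx : inner ℝ x (b x) ≠ 0) :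
    ContinuousAt (rayleigh a b) x := by
  unfold rayleigh
  exact ContinuousAt.div (by fun_prop) (by fun_prop) hx

theorem contDiffAt_rayleighGrad {x : E} (hx : inner ℝ x (b x) ≠ 0) :
    ContDiffAt ℝ 1 (rayleighGrad a b) x := by
  have h1 : ContDiffAt ℝ 1 (fun x => inner ℝ x (a x)) x :=
    contDiffAt_id.inner ℝ a.contDiff.contDiffAt
  have h2 : ContDiffAt ℝ 1 (fun x => inner ℝ x (b x)) x :=
    contDiffAt_id.inner ℝ b.contDiff.contDiffAt
  exact (contDiffAt_const.div h2 hx).smul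
    (a.contDiff.contDiffAt.sub ((h1.div h2 hx).smul b.contDiff.contDiffAt))

variable [FiniteDimensional ℝ E]

theorem exists_forall_le_inner_self_apply (hpos : ∀ x : E, x ≠ 0 → 0 < inner ℝ x (b x)) :
    ∃ m : ℝ, 0 < m ∧ ∀ x : E, ‖x‖ = 1 → m ≤ inner ℝ x (b x) := by
  have hcont : Continuous fun x : E => (inner ℝ x (b x) : ℝ) := by fun_prop
  by_cases hne : (Metric.sphere (0 : E) 1).Nonempty
  · obtain ⟨x, hx, hmin⟩ := (isCompact_sphere (0 : E) 1).exists_isMinOn hne hcont.continuousOn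
    refine ⟨_, hpos x fun h => ?_, fun y hy => hmin (by simpa using hy)⟩
    simp [h] at hx
  · exact ⟨1, one_pos, fun x hx => absurd ⟨x, by simpa using hx⟩ hne⟩

theorem exists_lipschitz_rayleighGrad (hpos : ∀ x : E, x ≠ 0 → 0 < inner ℝ x (b x)) :
    ∃ K : ℝ, 0 ≤ K ∧ ∀ x y : E, ‖x‖ = 1 → ‖y‖ = 1 →
      ‖rayleighGrad a b x - rayleighGrad a b y‖ ≤ K * ‖x - y‖ := by
  have hl : LocallyLipschitzOn (Metric.sphere (0 : E) 1) (rayleighGrad a b) := by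
    intro x hx
    have hx0 : x ≠ 0 := fun h => by simp [h] at hx
    obtain ⟨K, t, ht, hK⟩ :=
      (contDiffAt_rayleighGrad (a := a) (hpos x hx0).ne').exists_lipschitzOnWith
    exact ⟨K, t, mem_nhdsWithin_of_mem_nhds ht, hK⟩
  obtain ⟨K, hK⟩ := hl.exists_lipschitzOnWith_of_compact (isCompact_sphere (0 : E) 1)
  refine ⟨K, K.2, fun x y hx hy => ?_⟩
  exact hK.norm_sub_le (by simpa using hx) (by simpa using hy)

/-- A symmetric operator is nondegenerate modulo its kernel. -/
theorem exists_abs_inner_self_apply_le {N : E →ₗ[ℝ] E} (hN : N.IsSymmetric) :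
    ∃ C : ℝ, 0 < C ∧ ∀ x, |inner ℝ x (N x)| ≤ C * ‖N x‖ ^ 2 := by
  -- A linear right inverse of `N` on its range is bounded in finite dimension, and symmetry gives
  -- `⟨x, N x⟩ = ⟨N x, g (N x)⟩`.
  obtain ⟨g, hg⟩ := N.rangeRestrict.exists_rightInverse_of_surjective N.range_rangeRestrict
  let g' := LinearMap.toContinuousLinearMap g
  refine ⟨‖g'‖ + 1, by positivity, fun x => ?_⟩
  have h1 : N (g' (N.rangeRestrict x)) = N x := by
    have := LinearMap.congr_fun hg (N.rangeRestrict x)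
    exact congrArg Subtype.val this
  have h2 : inner ℝ x (N x) = (inner ℝ (N x) (g' (N.rangeRestrict x)) : ℝ) := by
    rw [hN, h1]
  rw [h2]
  calc |inner ℝ (N x) (g' (N.rangeRestrict x))| ≤ ‖N x‖ * ‖g' (N.rangeRestrict x)‖ :=
        abs_real_inner_le_norm _ _
    _ ≤ ‖N x‖ * (‖g'‖ * ‖N x‖) := by
        gcongr
        exact g'.le_opNorm (N.rangeRestrict x)
    _ ≤ (‖g'‖ + 1) * ‖N x‖ ^ 2 := by nlinarith [sq_nonneg ‖N x‖]

/-- On a subspace, the squared norm of the projected gradient of the Rayleigh quotient controls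
the distance of its values from any given value. -/
theorem exists_mul_abs_sub_le_norm_starProjection_rayleighGrad (ha : a.IsSymmetric)
    (hb : b.IsSymmetric) (hpos : ∀ x : E, x ≠ 0 → 0 < inner ℝ x (b x)) (V : Submodule ℝ E) (μ : ℝ) :
    ∃ ε : ℝ, 0 < ε ∧ ∃ c : ℝ, 0 < c ∧ ∀ x ∈ V, ‖x‖ = 1 → |rayleigh a b x - μ| < ε →
      c * |rayleigh a b x - μ| ≤ ‖V.starProjection (rayleighGrad a b x)‖ ^ 2 := by
  set P := V.starProjection with hP
  have hPs : ∀ x y, inner ℝ (P x) y = (inner ℝ x (P y) : ℝ) :=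
    V.inner_starProjection_left_eq_right
  let N : E →L[ℝ] E := P ∘L (a - μ • b) ∘L P
  have hN : (N : E →ₗ[ℝ] E).IsSymmetric := by
    intro x y
    have h1 := ha (P x) (P y)
    have h2 := hb (P x) (P y)
    change inner ℝ (P ((a - μ • b) (P x))) y = (inner ℝ x (P ((a - μ • b) (P y))) : ℝ)
    rw [hPs, ← hPs x]
    simp only [sub_apply, smul_apply, inner_sub_left,
      inner_sub_right, real_inner_smul_left, real_inner_smul_right]
    exact congrArg₂ _ h1 (congrArg _ h2)
  obtain ⟨C, hC, hNC⟩ := exists_abs_inner_self_apply_le hN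
  obtain ⟨m, hm, hmb⟩ := exists_forall_le_inner_self_apply hpos
  set K := ‖b‖ + 1 with hK
  have hK0 : 0 < K := by positivity
  -- The radius makes the error term `2 C s² K²` at most `|s| m / 2`, so it is absorbed on the left.
  -- The second constant then comes from the factor `2 / g` in the projected gradient and `g ≤ K`.
  refine ⟨m / (4 * C * K ^ 2), by positivity, m / (C * K ^ 2), by positivity, ?_⟩
  intro x hxV hx hε
  set s := rayleigh a b x - μ with hs
  set g : ℝ := inner ℝ x (b x) with hg
  have hgm : m ≤ g := hmb x hx
  have hg0 : 0 < g := hm.trans_le hgm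
  have hbx : ‖b x‖ ≤ K := by
    have := b.le_opNorm x
    rw [hx] at this
    linarith
  have hgK : g ≤ K := by
    have := real_inner_le_norm x (b x)
    rw [hx, one_mul] at this
    exact this.trans hbx
  have hPx : P x = x := V.starProjection_eq_self_iff.2 hxV
  have hNx : N x = P (a x) - μ • P (b x) := by simp [N, hPx]
  have hxN : inner ℝ x (N x) = s * g := by
    rw [hNx, inner_sub_right, real_inner_smul_right, ← hPs, ← hPs, hPx, hs, sub_mul, rayleigh,
      div_mul_cancel₀ _ hg0.ne']
  have hgrad : P (rayleighGrad a b x) = (2 / g) • (N x - s • P (b x)) := by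
    rw [rayleighGrad, map_smul, map_sub, map_smul, hNx, hs, sub_smul]
    congr 1
    abel
  have h1 : |s| * m ≤ C * ‖N x‖ ^ 2 := by
    have := hNC x
    rw [ContinuousLinearMap.coe_coe, hxN, abs_mul, abs_of_pos hg0] at this
    exact (mul_le_mul_of_nonneg_left hgm (abs_nonneg s)).trans this
  have h2 : ‖s • P (b x)‖ ≤ |s| * K := by
    rw [norm_smul, Real.norm_eq_abs]
    gcongr
    exact (V.norm_starProjection_apply_le _).trans hbx
  have h3 : ‖N x‖ ^ 2 ≤ 2 * ‖N x - s • P (b x)‖ ^ 2 + 2 * (|s| * K) ^ 2 := by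
    have h4 : ‖N x‖ ≤ ‖N x - s • P (b x)‖ + |s| * K := by
      have := norm_le_norm_sub_add (N x) (s • P (b x))
      linarith
    have h5 := pow_le_pow_left₀ (norm_nonneg _) h4 2
    nlinarith [sq_nonneg (‖N x - s • P (b x)‖ - |s| * K)]
  have h6 : |s| * K ^ 2 * (4 * C) ≤ m := by
    rw [lt_div_iff₀ (by positivity)] at hε
    linarith
  have h7 : |s| * m ≤ 4 * C * ‖N x - s • P (b x)‖ ^ 2 := by
    have h8 := mul_le_mul_of_nonneg_left h3 hC.le
    have h9 := mul_le_mul_of_nonneg_left h6 (abs_nonneg s)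
    nlinarith
  rw [hgrad, norm_smul, mul_pow, Real.norm_of_nonneg (by positivity), div_pow,
    div_mul_eq_mul_div, div_mul_eq_mul_div, div_le_div_iff₀ (by positivity) (by positivity)]
  have h10 : g ^ 2 ≤ K ^ 2 := pow_le_pow_left₀ hg0.le hgK 2
  calc m * |s| * g ^ 2 ≤ m * |s| * K ^ 2 := by gcongr
    _ ≤ (4 * C * ‖N x - s • P (b x)‖ ^ 2) * K ^ 2 := by
        rw [mul_comm m]
        gcongr
    _ = _ := by ring

end Rayleigh

/-! ### KL exponent 1/2 on the unit vectors of a finite union of subspaces -/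

section UnionOfSubspaces

variable {E : Type*} [NormedAddCommGroup E] [InnerProductSpace ℝ E] {a b : E →L[ℝ] E}
  {ι : Type*} {V : ι → Submodule ℝ E}

/-- The unit vectors in a union of subspaces. -/
def unitUnion (V : ι → Submodule ℝ E) : Set E := {x | ‖x‖ = 1 ∧ ∃ i, x ∈ V i}

/-- The Rayleigh quotient restricted to the unit vectors in a union of subspaces. -/
def rayleighOn (a b : E →L[ℝ] E) (V : ι → Submodule ℝ E) (x : E) : EReal :=
  (rayleigh a b x : EReal) + indicatorFun (unitUnion V) x

theorem rayleighOn_of_mem {x : E} (hx : x ∈ unitUnion V) :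
    rayleighOn a b V x = rayleigh a b x := by
  simp [rayleighOn, indicatorFun, hx]

theorem rayleighOn_of_notMem {x : E} (hx : x ∉ unitUnion V) : rayleighOn a b V x = ⊤ := by
  simp [rayleighOn, indicatorFun, hx]

theorem ne_zero_of_mem_unitUnion {x : E} (hx : x ∈ unitUnion V) : x ≠ 0 := by
  rintro rfl
  simpa using hx.1

theorem rayleigh_le_rayleighOn (x : E) : (rayleigh a b x : EReal) ≤ rayleighOn a b V x := by
  by_cases hx : x ∈ unitUnion V
  · rw [rayleighOn_of_mem hx]
  · rw [rayleighOn_of_notMem hx]; exact le_top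

theorem isClosed_unitUnion [FiniteDimensional ℝ E] [Finite ι] : IsClosed (unitUnion V) := by
  have : unitUnion V = Metric.sphere 0 1 ∩ ⋃ i, (V i : Set E) := by
    ext x; simp [unitUnion]
  rw [this]
  exact Metric.isClosed_sphere.inter
    (isClosed_iUnion_of_finite fun i => (V i).closed_of_finiteDimensional)

theorem isProper_rayleighOn (hne : (unitUnion V).Nonempty) : IsProper (rayleighOn a b V) := by
  obtain ⟨x, hx⟩ := hne
  refine ⟨⟨x, by rw [rayleighOn_of_mem hx]; exact EReal.coe_lt_top _⟩, fun y hy => ?_⟩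
  have := rayleigh_le_rayleighOn (a := a) (b := b) (V := V) y
  rw [hy] at this
  exact EReal.coe_ne_bot _ (le_bot_iff.1 this)

theorem lowerSemicontinuous_rayleighOn [FiniteDimensional ℝ E] [Finite ι]
    (hpos : ∀ x : E, x ≠ 0 → 0 < inner ℝ x (b x)) : LowerSemicontinuous (rayleighOn a b V) := by
  intro x y hy
  by_cases hx : x ∈ unitUnion V
  · rw [rayleighOn_of_mem hx] at hy
    have hc := (continuousAt_rayleigh (a := a) (hpos x (ne_zero_of_mem_unitUnion hx)).ne')
    have : ContinuousAt (fun x => (rayleigh a b x : EReal)) x :=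
      continuous_coe_real_ereal.continuousAt.comp hc
    filter_upwards [this.eventually (lt_mem_nhds hy)] with z hz
    exact hz.trans_le (rayleigh_le_rayleighOn z)
  · filter_upwards [isClosed_unitUnion.isOpen_compl.mem_nhds hx] with z hz
    rw [rayleighOn_of_notMem hz]
    rwa [rayleighOn_of_notMem hx] at hy

theorem mem_unitUnion_of_rayleighOn_ne_top {x : E} (hx : rayleighOn a b V x ≠ ⊤) :
    x ∈ unitUnion V := by
  by_contra h
  exact hx (rayleighOn_of_notMem h)

theorem mem_unitUnion_of_mem_subdiffDomain {x : E} (hx : x ∈ subdiffDomain (rayleighOn a b V)) :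
    x ∈ unitUnion V := by
  obtain ⟨u, hu⟩ := hx
  exact mem_unitUnion_of_rayleighOn_ne_top hu.1

/-- Tangent directions of the unit sphere of a subspace are velocities of curves inside it. -/
theorem exists_curve_mem_unitUnion {x h : E} {i : ι} (hx : x ∈ V i) (hx1 : ‖x‖ = 1)
    (hh : h ∈ V i) (hxh : inner ℝ x h = 0) :
    ∃ c : ℝ → E, HasDerivAt c h 0 ∧ c 0 = x ∧ ∀ t, c t ∈ unitUnion V := by
  have hp : ∀ t : ℝ, 0 < 1 + t ^ 2 * ‖h‖ ^ 2 := fun t => by positivity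
  have hnorm : ∀ t : ℝ, ‖x + t • h‖ = √(1 + t ^ 2 * ‖h‖ ^ 2) := by
    intro t
    rw [eq_comm, Real.sqrt_eq_iff_mul_self_eq (hp t).le (norm_nonneg _), ← sq, norm_add_sq_real,
      hx1, real_inner_smul_right, hxh, norm_smul, mul_pow, Real.norm_eq_abs, sq_abs]
    ring
  -- The normalized line `x + t h`: orthogonality makes its norm even in `t`, so normalizing leaves
  -- the velocity at 0 unchanged.
  refine ⟨fun t => (√(1 + t ^ 2 * ‖h‖ ^ 2))⁻¹ • (x + t • h), ?_, by simp, fun t => ⟨?_, i, ?_⟩⟩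
  · have h1 : HasDerivAt (fun t : ℝ => 1 + t ^ 2 * ‖h‖ ^ 2) 0 0 := by
      simpa using (((hasDerivAt_id (0 : ℝ)).pow 2).mul_const (‖h‖ ^ 2)).const_add 1
    have h2 : HasDerivAt (fun t : ℝ => (√(1 + t ^ 2 * ‖h‖ ^ 2))⁻¹) 0 0 := by
      simpa using (h1.sqrt (by simp)).fun_inv (by simp)
    have h3 : HasDerivAt (fun t : ℝ => x + t • h) h 0 := by
      simpa using ((hasDerivAt_id (0 : ℝ)).smul_const h).const_add x
    simpa using h2.fun_smul h3
  · have : 0 < √(1 + t ^ 2 * ‖h‖ ^ 2) := Real.sqrt_pos.2 (hp t)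
    rw [norm_smul, hnorm, Real.norm_of_nonneg (by positivity), inv_mul_cancel₀ this.ne']
  · exact (V i).smul_mem _ ((V i).add_mem hx ((V i).smul_mem _ hh))

/-- By Cauchy–Schwarz. The hypothesis is what a test along a curve of velocity `-h` gives when the
function has slope `-‖h‖²`. -/
theorem le_norm_of_inner_neg_le {u h : E} (huh : inner ℝ u (-h) ≤ -‖h‖ ^ 2) : ‖h‖ ≤ ‖u‖ := by
  rw [inner_neg_right, neg_le_neg_iff] at huh
  have := huh.trans (real_inner_le_norm u h)
  by_contra! hlt
  nlinarith [norm_nonneg u]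

variable [FiniteDimensional ℝ E]

/-- A uniform bound, over the subspaces of a finite union, of the distance of the values of the
Rayleigh quotient from a given value. -/
theorem exists_mul_abs_sub_le_of_mem_unitUnion [Finite ι] (ha : a.IsSymmetric)
    (hb : b.IsSymmetric) (hpos : ∀ x : E, x ≠ 0 → 0 < inner ℝ x (b x)) (V : ι → Submodule ℝ E)
    (μ : ℝ) :
    ∃ ε : ℝ, 0 < ε ∧ ∃ c : ℝ, 0 < c ∧ ∀ i, ∀ x ∈ V i, ‖x‖ = 1 → |rayleigh a b x - μ| < ε →
      c * |rayleigh a b x - μ| ≤ ‖(V i).starProjection (rayleighGrad a b x)‖ ^ 2 := by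
  cases nonempty_fintype ι
  choose ε hε c hc h using fun i =>
    exists_mul_abs_sub_le_norm_starProjection_rayleighGrad ha hb hpos (V i) μ
  have hfin : ∀ f : ι → ℝ, (∀ i, 0 < f i) → ∃ e : ℝ, 0 < e ∧ ∀ i, e ≤ f i := by
    intro f hf
    rcases isEmpty_or_nonempty ι with hι | hι
    · exact ⟨1, one_pos, fun i => hι.elim i⟩
    · obtain ⟨i, hi⟩ := Finite.exists_min f
      exact ⟨f i, hf i, hi⟩
  obtain ⟨e, he, hee⟩ := hfin ε hε
  obtain ⟨k, hk, hkk⟩ := hfin c hc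
  refine ⟨e, he, k, hk, fun i x hx hx1 hxe => ?_⟩
  exact (mul_le_mul_of_nonneg_right (hkk i) (abs_nonneg _)).trans
    (h i x hx hx1 (hxe.trans_le (hee i)))

/-- The projected gradient of the Rayleigh quotient is a tangent direction. -/
theorem inner_starProjection_rayleighGrad {x : E} {W : Submodule ℝ E} (hx : x ∈ W)
    (hbx : inner ℝ x (b x) ≠ 0) :
    inner ℝ x (W.starProjection (rayleighGrad a b x)) = 0 := by
  rw [← W.inner_starProjection_left_eq_right, W.starProjection_eq_self_iff.2 hx, real_inner_comm,
    inner_rayleighGrad_self hbx]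

theorem norm_sq_starProjection (W : Submodule ℝ E) (v : E) :
    inner ℝ v (W.starProjection v) = ‖W.starProjection v‖ ^ 2 := by
  rw [← real_inner_self_eq_norm_sq, W.inner_starProjection_left_eq_right,
    W.starProjection_eq_self_iff.2 (W.starProjection_apply_mem v)]

/-- Steepest descent inside `V i`: along a curve on its sphere with velocity `-h`, where `h` is the
projected gradient, the quotient has slope `-‖h‖²`. -/
theorem norm_starProjection_rayleighGrad_le (ha : a.IsSymmetric) (hb : b.IsSymmetric)
    (hpos : ∀ x : E, x ≠ 0 → 0 < inner ℝ x (b x)) {x u : E} {i : ι} (hx : x ∈ V i) (hx1 : ‖x‖ = 1)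
    (hu : u ∈ frechetSubdiff (rayleighOn a b V) x) :
    ‖(V i).starProjection (rayleighGrad a b x)‖ ≤ ‖u‖ := by
  have hx0 : x ≠ 0 := ne_zero_of_mem_unitUnion (V := V) ⟨hx1, i, hx⟩
  have hbx := (hpos x hx0).ne'
  set h := (V i).starProjection (rayleighGrad a b x) with hh
  obtain ⟨c, hc, hc0, hcV⟩ := exists_curve_mem_unitUnion (h := -h) hx hx1
    ((V i).neg_mem ((V i).starProjection_apply_mem _))
    (by rw [inner_neg_right, inner_starProjection_rayleighGrad hx hbx, neg_zero])
  refine le_norm_of_inner_neg_le ?_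
  refine inner_le_of_mem_frechetSubdiff hu hc hc0 (φ := fun t => rayleigh a b (c t)) ?_
    (fun t => rayleighOn_of_mem (hcV t))
  have h1 := (hasGradientAt_rayleigh ha hb hbx).hasFDerivAt
  rw [← hc0] at h1
  refine (h1.comp_hasDerivAt (0 : ℝ) hc).congr_deriv ?_
  rw [InnerProductSpace.toDual_apply_apply, hc0, inner_neg_right, norm_sq_starProjection]

/-- Only the value at `x` must be close to `μ`; `x` itself need not be near any given point. The
convergence proof relies on this uniformity. -/
theorem exists_mul_abs_sub_le_norm_sq_of_mem_frechetSubdiff [Finite ι] (ha : a.IsSymmetric)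
    (hb : b.IsSymmetric) (hpos : ∀ x : E, x ≠ 0 → 0 < inner ℝ x (b x)) (V : ι → Submodule ℝ E)
    (μ : ℝ) :
    ∃ ε : ℝ, 0 < ε ∧ ∃ c : ℝ, 0 < c ∧ ∀ x, ∀ u ∈ frechetSubdiff (rayleighOn a b V) x,
      |rayleigh a b x - μ| < ε → c * |rayleigh a b x - μ| ≤ ‖u‖ ^ 2 := by
  obtain ⟨ε, hε, c, hc, h⟩ := exists_mul_abs_sub_le_of_mem_unitUnion ha hb hpos V μ
  refine ⟨ε, hε, c, hc, fun x u hu hxε => ?_⟩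
  obtain ⟨hx1, i, hi⟩ := mem_unitUnion_of_rayleighOn_ne_top hu.1
  exact (h i x hi hx1 hxε).trans (pow_le_pow_left₀ (norm_nonneg _)
    (norm_starProjection_rayleighGrad_le ha hb hpos hi hx1 hu) 2)

theorem hasKLPropertyWithExponent_rayleighOn [Finite ι] (ha : a.IsSymmetric)
    (hb : b.IsSymmetric) (hpos : ∀ x : E, x ≠ 0 → 0 < inner ℝ x (b x)) {xbar : E}
    (hx : xbar ∈ subdiffDomain (rayleighOn a b V)) :
    HasKLPropertyWithExponent (rayleighOn a b V) xbar (1 / 2) := by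
  have hxS := mem_unitUnion_of_mem_subdiffDomain hx
  obtain ⟨ε, hε, c, hc, h⟩ := exists_mul_abs_sub_le_norm_sq_of_mem_frechetSubdiff ha hb hpos V
    (rayleigh a b xbar)
  refine hasKLPropertyWithExponent_half (isProper_rayleighOn ⟨xbar, hxS⟩)
    (lowerSemicontinuous_rayleighOn hpos) hx (rayleighOn_of_mem hxS) hc ?_
  have hcont := continuousAt_rayleigh (a := a) (hpos xbar (ne_zero_of_mem_unitUnion hxS)).ne'
  filter_upwards [Metric.continuousAt_iff'.1 hcont ε hε] with x hxε v hv
  rw [rayleighOn_of_mem (mem_unitUnion_of_rayleighOn_ne_top hv.1), EReal.toReal_coe]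
  exact (mul_le_mul_of_nonneg_left (le_abs_self _) hc.le).trans (h x v hv hxε)

end UnionOfSubspaces

/-! ### KL exponent 1/2 for the merit function on the diagonal -/

section Merit

variable {E : Type*} [NormedAddCommGroup E] [InnerProductSpace ℝ E] {a b : E →L[ℝ] E}
  {ι : Type*} {V : ι → Submodule ℝ E} {ρ : ℝ}

/-- The merit function `(x, u) ↦ R(x) + ρ ‖x - u‖²` for the restricted Rayleigh quotient `R`. -/
def meritOn (a b : E →L[ℝ] E) (V : ι → Submodule ℝ E) (ρ : ℝ) (z : WithLp 2 (E × E)) : EReal :=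
  rayleighOn a b V z.fst + ((ρ * ‖z.fst - z.snd‖ ^ 2 : ℝ) : EReal)

theorem meritOn_of_mem {z : WithLp 2 (E × E)} (hz : z.fst ∈ unitUnion V) :
    meritOn a b V ρ z = ((rayleigh a b z.fst + ρ * ‖z.fst - z.snd‖ ^ 2 : ℝ) : EReal) := by
  rw [meritOn, rayleighOn_of_mem hz, EReal.coe_add]

theorem meritOn_of_notMem {z : WithLp 2 (E × E)} (hz : z.fst ∉ unitUnion V) :
    meritOn a b V ρ z = ⊤ := by
  rw [meritOn, rayleighOn_of_notMem hz, EReal.top_add_coe]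

theorem mem_unitUnion_of_meritOn_ne_top {z : WithLp 2 (E × E)} (hz : meritOn a b V ρ z ≠ ⊤) :
    z.fst ∈ unitUnion V := by
  by_contra h
  exact hz (meritOn_of_notMem h)

theorem coe_le_meritOn (z : WithLp 2 (E × E)) :
    ((rayleigh a b z.fst + ρ * ‖z.fst - z.snd‖ ^ 2 : ℝ) : EReal) ≤ meritOn a b V ρ z := by
  by_cases hz : z.fst ∈ unitUnion V
  · rw [meritOn_of_mem hz]
  · rw [meritOn_of_notMem hz]; exact le_top

theorem rayleighOn_le_meritOn (hρ : 0 ≤ ρ) (z : WithLp 2 (E × E)) :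
    rayleighOn a b V z.fst ≤ meritOn a b V ρ z := by
  by_cases hz : z.fst ∈ unitUnion V
  · rw [meritOn_of_mem hz, rayleighOn_of_mem hz, EReal.coe_le_coe_iff]
    nlinarith [sq_nonneg ‖z.fst - z.snd‖]
  · rw [meritOn_of_notMem hz]; exact le_top

theorem isProper_meritOn (hne : (unitUnion V).Nonempty) : IsProper (meritOn a b V ρ) := by
  obtain ⟨x, hx⟩ := hne
  refine ⟨⟨WithLp.toLp 2 (x, x), ?_⟩, fun y hy => ?_⟩
  · rw [meritOn_of_mem (z := WithLp.toLp 2 (x, x)) hx]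
    exact EReal.coe_lt_top _
  · have := coe_le_meritOn (a := a) (b := b) (V := V) (ρ := ρ) y
    rw [hy] at this
    exact EReal.coe_ne_bot _ (le_bot_iff.1 this)

theorem lowerSemicontinuous_meritOn [FiniteDimensional ℝ E] [Finite ι]
    (hpos : ∀ x : E, x ≠ 0 → 0 < inner ℝ x (b x)) : LowerSemicontinuous (meritOn a b V ρ) := by
  intro z y hy
  by_cases hz : z.fst ∈ unitUnion V
  · rw [meritOn_of_mem hz] at hy
    have hc : ContinuousAt (fun z : WithLp 2 (E × E) => rayleigh a b z.fst) z :=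
      (continuousAt_rayleigh (a := a) (hpos _ (ne_zero_of_mem_unitUnion hz)).ne').comp
        (WithLp.fstL 2 ℝ E E).continuous.continuousAt
    have hc2 : Continuous fun z : WithLp 2 (E × E) => ρ * ‖z.fst - z.snd‖ ^ 2 :=
      (((WithLp.fstL 2 ℝ E E).continuous.sub (WithLp.sndL 2 ℝ E E).continuous).norm.pow 2).const_mul ρ
    have : ContinuousAt (fun z : WithLp 2 (E × E) =>
        ((rayleigh a b z.fst + ρ * ‖z.fst - z.snd‖ ^ 2 : ℝ) : EReal)) z :=
      continuous_coe_real_ereal.continuousAt.comp (hc.add hc2.continuousAt)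
    filter_upwards [this.eventually (lt_mem_nhds hy)] with w hw
    exact hw.trans_le (coe_le_meritOn w)
  · filter_upwards [(WithLp.fstL 2 ℝ E E).continuous.continuousAt.preimage_mem_nhds
      (isClosed_unitUnion.isOpen_compl.mem_nhds hz)] with w hw
    rw [meritOn_of_notMem hw]
    rwa [meritOn_of_notMem hz] at hy

/-- The penalty is nonnegative and vanishes on the diagonal, so a local minorant of the quotient
also minorizes the merit function. -/
theorem toLp_mem_frechetSubdiff_meritOn (hρ : 0 ≤ ρ) {y v : E}
    (hv : v ∈ frechetSubdiff (rayleighOn a b V) y) :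
    WithLp.toLp 2 (v, 0) ∈ frechetSubdiff (meritOn a b V ρ) (WithLp.toLp 2 (y, y)) := by
  have hy := mem_unitUnion_of_rayleighOn_ne_top hv.1
  refine mem_frechetSubdiff_of_eventually_le (m := rayleigh a b y) ?_ fun ε hε => ?_
  · rw [meritOn_of_mem (z := WithLp.toLp 2 (y, y)) hy]
    simp
  have ht : Tendsto (fun z : WithLp 2 (E × E) => z.fst) (𝓝 (WithLp.toLp 2 (y, y))) (𝓝 y) :=
    (WithLp.fstL 2 ℝ E E).continuous.tendsto (WithLp.toLp 2 (y, y))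
  filter_upwards [ht.eventually (eventually_le_of_mem_frechetSubdiff hv (rayleighOn_of_mem hy) hε)]
    with z hz
  refine le_trans ?_ (hz.trans (rayleighOn_le_meritOn hρ z))
  rw [EReal.coe_le_coe_iff, WithLp.prod_inner_apply]
  have := WithLp.norm_fst_le E (p := 2) (z - WithLp.toLp 2 (y, y))
  have := mul_le_mul_of_nonneg_left this hε.le
  simp at this ⊢
  linarith

theorem toLp_mem_subdiffDomain_meritOn (hρ : 0 ≤ ρ) {x : E}
    (hx : x ∈ subdiffDomain (rayleighOn a b V)) :
    WithLp.toLp 2 (x, x) ∈ subdiffDomain (meritOn a b V ρ) := by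
  have hxS := mem_unitUnion_of_mem_subdiffDomain hx
  obtain ⟨u, -, -, y, v, hy, hfy, hv, hyv⟩ := hx
  have hval : ∀ z ∈ unitUnion V, meritOn a b V ρ (WithLp.toLp 2 (z, z)) = rayleighOn a b V z := by
    intro z hz
    rw [meritOn_of_mem (z := WithLp.toLp 2 (z, z)) hz, rayleighOn_of_mem hz]
    simp
  have hyS : ∀ n, y n ∈ unitUnion V := fun n => mem_unitUnion_of_rayleighOn_ne_top (hyv n).1
  have hcont := WithLp.prod_continuous_toLp 2 E E
  refine ⟨WithLp.toLp 2 (u, 0), ?_, ?_, fun n => WithLp.toLp 2 (y n, y n),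
    fun n => WithLp.toLp 2 (v n, 0), (hcont.tendsto _).comp (hy.prodMk_nhds hy), ?_,
    (hcont.tendsto _).comp (hv.prodMk_nhds tendsto_const_nhds),
    fun n => toLp_mem_frechetSubdiff_meritOn hρ (hyv n)⟩
  · rw [hval x hxS, rayleighOn_of_mem hxS]; exact EReal.coe_ne_top _
  · rw [hval x hxS, rayleighOn_of_mem hxS]; exact EReal.coe_ne_bot _
  · simpa only [hval x hxS, hval _ (hyS _)] using hfy

theorem hasDerivAt_toLp {c k : ℝ → E} {h l : E} (hc : HasDerivAt c h 0) (hk : HasDerivAt k l 0) :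
    HasDerivAt (fun t => WithLp.toLp 2 (c t, k t)) (WithLp.toLp 2 (h, l)) 0 :=
  ((WithLp.prodContinuousLinearEquiv 2 ℝ E E).symm.toContinuousLinearMap.hasFDerivAt
    (x := (c 0, k 0))).comp_hasDerivAt (0 : ℝ) (hc.prodMk hk)

/-- Only the second variable moves, towards the first, so the slope comes from the penalty alone. -/
theorem two_mul_norm_sub_le_norm_snd (hρ : 0 ≤ ρ) {z p : WithLp 2 (E × E)}
    (hp : p ∈ frechetSubdiff (meritOn a b V ρ) z) :
    2 * ρ * ‖z.fst - z.snd‖ ≤ ‖p.snd‖ := by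
  have hz := mem_unitUnion_of_meritOn_ne_top hp.1
  set h : E := -((2 * ρ) • (z.fst - z.snd)) with hh
  have hk := hasDerivAt_add_smul z.snd (-h)
  have hφ : HasDerivAt (fun t : ℝ => rayleigh a b z.fst + ρ * ‖z.fst - (z.snd + t • (-h))‖ ^ 2)
      (-‖h‖ ^ 2) 0 := by
    refine (((hk.const_sub z.fst).norm_sq.const_mul ρ).const_add _).congr_deriv ?_
    rw [← real_inner_self_eq_norm_sq h]
    simp only [hh, zero_smul, add_zero, neg_neg, inner_neg_right, inner_neg_left,
      real_inner_smul_right, real_inner_smul_left]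
    ring
  have key := inner_le_of_mem_frechetSubdiff hp (hasDerivAt_toLp (hasDerivAt_const 0 z.fst) hk)
    (by simp; rfl) hφ (fun t => meritOn_of_mem (z := WithLp.toLp 2 (z.fst, _)) hz)
  rw [WithLp.prod_inner_apply] at key
  have := le_norm_of_inner_neg_le (u := p.snd) (h := h) (by simpa using key)
  rwa [hh, norm_neg, norm_smul, Real.norm_of_nonneg (by positivity)] at this

variable [FiniteDimensional ℝ E]

/-- Both variables move with the same velocity, so the penalty is stationary and the slope comes
from the quotient alone. -/
theorem norm_starProjection_rayleighGrad_le_norm_add (ha : a.IsSymmetric) (hb : b.IsSymmetric)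
    (hpos : ∀ x : E, x ≠ 0 → 0 < inner ℝ x (b x)) {z p : WithLp 2 (E × E)} {i : ι}
    (hx : z.fst ∈ V i) (hx1 : ‖z.fst‖ = 1) (hp : p ∈ frechetSubdiff (meritOn a b V ρ) z) :
    ‖(V i).starProjection (rayleighGrad a b z.fst)‖ ≤ ‖p.fst + p.snd‖ := by
  have hbx := (hpos z.fst (ne_zero_of_mem_unitUnion (V := V) ⟨hx1, i, hx⟩)).ne'
  set h := (V i).starProjection (rayleighGrad a b z.fst) with hh
  obtain ⟨c, hc, hc0, hcV⟩ := exists_curve_mem_unitUnion (h := -h) hx hx1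
    ((V i).neg_mem ((V i).starProjection_apply_mem _))
    (by rw [inner_neg_right, inner_starProjection_rayleighGrad hx hbx, neg_zero])
  refine le_norm_of_inner_neg_le ?_
  have hk := hasDerivAt_add_smul z.snd (-h)
  have h1 := (hasGradientAt_rayleigh ha hb hbx).hasFDerivAt
  rw [← hc0] at h1
  have hφ : HasDerivAt (fun t : ℝ => rayleigh a b (c t) + ρ * ‖c t - (z.snd + t • (-h))‖ ^ 2)
      (-‖h‖ ^ 2) 0 := by
    refine ((h1.comp_hasDerivAt (0 : ℝ) hc).add
      ((hc.sub hk).norm_sq.const_mul ρ)).congr_deriv ?_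
    rw [InnerProductSpace.toDual_apply_apply, hc0, inner_neg_right, norm_sq_starProjection,
      sub_self, inner_zero_right]
    ring
  have key := inner_le_of_mem_frechetSubdiff hp (hasDerivAt_toLp hc hk)
    (by simp [hc0]; rfl) hφ (fun t => meritOn_of_mem (z := WithLp.toLp 2 (c t, _)) (hcV t))
  rw [WithLp.prod_inner_apply] at key
  rw [inner_add_left]
  exact key

theorem hasKLPropertyWithExponent_meritOn [Finite ι] (ha : a.IsSymmetric)
    (hb : b.IsSymmetric) (hpos : ∀ x : E, x ≠ 0 → 0 < inner ℝ x (b x)) (hρ : 0 ≤ ρ) {xbar : E}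
    (hx : xbar ∈ subdiffDomain (rayleighOn a b V)) :
    HasKLPropertyWithExponent (meritOn a b V ρ) (WithLp.toLp 2 (xbar, xbar)) (1 / 2) := by
  have hxS := mem_unitUnion_of_mem_subdiffDomain hx
  obtain ⟨ε, hε, c, hc, h⟩ := exists_mul_abs_sub_le_of_mem_unitUnion ha hb hpos V
    (rayleigh a b xbar)
  -- The two bounds make `k s` at most `(‖p.fst‖ + ‖p.snd‖)² / 4` and `k ρ D²` at most `‖p.snd‖² /
  -- 2`, which sum to at most `‖p‖²`. The second is kept multiplied by `ρ` so that `ρ = 0` is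
  -- allowed.
  obtain ⟨k, hk, hkc, hkρ⟩ : ∃ k : ℝ, 0 < k ∧ k ≤ c / 4 ∧ k * ρ ≤ 2 * ρ ^ 2 := by
    rcases hρ.eq_or_lt with rfl | hρ
    · exact ⟨c / 4, by positivity, le_rfl, by simp⟩
    · refine ⟨min (c / 4) (2 * ρ), by positivity, min_le_left _ _, ?_⟩
      have := mul_le_mul_of_nonneg_right (min_le_right (c / 4) (2 * ρ)) hρ.le
      linarith
  refine hasKLPropertyWithExponent_half (isProper_meritOn ⟨xbar, hxS⟩)
    (lowerSemicontinuous_meritOn hpos) (toLp_mem_subdiffDomain_meritOn hρ hx)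
    (m := rayleigh a b xbar) ?_ hk ?_
  · rw [meritOn_of_mem (z := WithLp.toLp 2 (xbar, xbar)) hxS]
    simp
  have hcont := continuousAt_rayleigh (a := a) (hpos xbar (ne_zero_of_mem_unitUnion hxS)).ne'
  have ht : Tendsto (fun z : WithLp 2 (E × E) => z.fst) (𝓝 (WithLp.toLp 2 (xbar, xbar)))
      (𝓝 xbar) := (WithLp.fstL 2 ℝ E E).continuous.tendsto (WithLp.toLp 2 (xbar, xbar))
  filter_upwards [ht.eventually (Metric.continuousAt_iff'.1 hcont ε hε)] with z hzε p hp
  have hz := mem_unitUnion_of_meritOn_ne_top hp.1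
  rw [meritOn_of_mem hz, EReal.toReal_coe]
  obtain ⟨hz1, i, hi⟩ := hz
  have h1 := h i z.fst hi hz1 hzε
  have h2 := norm_starProjection_rayleighGrad_le_norm_add ha hb hpos hi hz1 hp
  have h3 := two_mul_norm_sub_le_norm_snd hρ hp
  set s := rayleigh a b z.fst - rayleigh a b xbar with hs
  set D := ‖z.fst - z.snd‖ with hD
  have h4 : c * |s| ≤ (‖p.fst‖ + ‖p.snd‖) ^ 2 := h1.trans
    (pow_le_pow_left₀ (norm_nonneg _) (h2.trans (norm_add_le _ _)) 2)
  have h5 : (2 * ρ * D) ^ 2 ≤ ‖p.snd‖ ^ 2 := pow_le_pow_left₀ (by positivity) h3 2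
  have h6 : k * s ≤ c / 4 * |s| :=
    (mul_le_mul_of_nonneg_left (le_abs_self s) hk.le).trans
      (mul_le_mul_of_nonneg_right hkc (abs_nonneg s))
  have h7 := mul_le_mul_of_nonneg_right hkρ (sq_nonneg D)
  rw [WithLp.prod_norm_sq_eq_of_L2]
  nlinarith [sq_nonneg (‖p.fst‖ - ‖p.snd‖), sq_nonneg ‖p.fst‖]

end Merit

/-! ### Geometric decay of real sequences and of steps -/

section LinearConvergence

/-- Linear decay of a sequence that satisfies a sufficient decrease and a relative error
condition. -/
theorem exists_le_mul_pow_of_decrease {h D : ℕ → ℝ} {κ K : ℝ} (hκ : 0 < κ) (hK : 0 < K)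
    (hh : ∀ n, 0 ≤ h n) (hD : ∀ n, 0 ≤ D n)
    (hdec : ∀ n, h (n + 1) + κ * (D (n + 1) + D n) ≤ h n)
    (herr : ∀ᶠ n in atTop, h (n + 1) ≤ K * (D (n + 1) + D n)) :
    ∃ C q : ℝ, 0 < C ∧ 0 < q ∧ q < 1 ∧ ∀ n, h n ≤ C * q ^ n ∧ D n ≤ C * q ^ n := by
  obtain ⟨N, hN⟩ := eventually_atTop.1 herr
  -- Eliminating `D (n + 1) + D n` from the two conditions gives `(K + κ) h (n + 1) ≤ K h n`.
  set q := K / (K + κ) with hq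
  have hKκ : 0 < K + κ := by positivity
  have hq0 : 0 < q := by positivity
  have hq1 : q < 1 := (div_lt_one hKκ).2 (by linarith)
  have hanti : Antitone h := antitone_nat_of_succ_le fun n => by
    have := mul_nonneg hκ.le (add_nonneg (hD (n + 1)) (hD n))
    linarith [hdec n]
  -- Dividing by `q ^ N` covers the indices up to `N`, where only monotonicity is available.
  set C := (h 0 + 1) / q ^ N with hC
  have hC0 : 0 < C := div_pos (by linarith [hh 0]) (by positivity)
  have hlow : ∀ n ≤ N, h n ≤ C * q ^ n := by
    intro n hn
    have h1 : q ^ N ≤ q ^ n := pow_le_pow_of_le_one hq0.le hq1.le hn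
    have h2 := hanti (Nat.zero_le n)
    calc h n ≤ C * q ^ N := by
          rw [hC, div_mul_cancel₀ _ (by positivity)]
          linarith
      _ ≤ C * q ^ n := by gcongr
  have hall : ∀ n, h n ≤ C * q ^ n := by
    intro n
    rcases le_total n N with hn | hn
    · exact hlow n hn
    induction n, hn using Nat.le_induction with
    | base => exact hlow N le_rfl
    | succ n hn ih =>
      have h1 : h (n + 1) * (K + κ) ≤ K * h n := by
        have h2 := mul_le_mul_of_nonneg_left (hN n hn) hκ.le
        have h3 := mul_le_mul_of_nonneg_left (hdec n) hK.le
        linarith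
      have h2 : h (n + 1) ≤ q * h n := by
        rw [hq, div_mul_eq_mul_div, le_div_iff₀ hKκ]
        exact h1
      calc h (n + 1) ≤ q * (C * q ^ n) := h2.trans (by gcongr)
        _ = C * q ^ (n + 1) := by ring
  refine ⟨C * max 1 κ⁻¹, q, by positivity, hq0, hq1, fun n => ⟨?_, ?_⟩⟩
  · refine (hall n).trans ?_
    gcongr
    exact le_mul_of_one_le_right hC0.le (le_max_left _ _)
  · have h1 : D n ≤ κ⁻¹ * h n := by
      rw [inv_mul_eq_div, le_div_iff₀ hκ]
      have := mul_nonneg hκ.le (hD (n + 1))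
      linarith [hdec n, hh (n + 1)]
    calc D n ≤ κ⁻¹ * (C * q ^ n) := h1.trans (by gcongr; exact hall n)
      _ ≤ max 1 κ⁻¹ * (C * q ^ n) := by gcongr; exact le_max_right _ _
      _ = _ := by ring

/-- A sequence in a complete space whose squared steps decay linearly converges linearly. -/
theorem exists_tendsto_of_norm_sub_sq_le {E : Type*} [NormedAddCommGroup E] [CompleteSpace E]
    {x : ℕ → E} {C q : ℝ} (hC : 0 < C) (hq0 : 0 < q) (hq1 : q < 1)
    (h : ∀ n, ‖x (n + 1) - x n‖ ^ 2 ≤ C * q ^ n) :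
    Summable (fun n => ‖x (n + 1) - x n‖) ∧ ∃ xstar, Tendsto x atTop (𝓝 xstar) ∧
      ∃ γ : ℝ, 0 < γ ∧ ∀ n : ℕ, ‖x n - xstar‖ ≤ γ * q ^ ((n : ℝ) / 2) := by
  -- The squared steps have ratio `q`, hence the steps have ratio `√q`; this is the source of the
  -- exponent `n / 2`.
  have hr1 : √q < 1 := by rwa [Real.sqrt_lt' one_pos, one_pow]
  have hstep : ∀ n, ‖x (n + 1) - x n‖ ≤ √C * √q ^ n := by
    intro n
    refine le_of_sq_le_sq ((h n).trans_eq ?_) (by positivity)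
    rw [mul_pow, ← pow_mul, mul_comm n, pow_mul, Real.sq_sqrt hC.le, Real.sq_sqrt hq0.le]
  have hdist : ∀ n, dist (x n) (x (n + 1)) ≤ √C * √q ^ n := fun n => by
    rw [dist_comm, dist_eq_norm]
    exact hstep n
  refine ⟨Summable.of_nonneg_of_le (fun n => norm_nonneg _) hstep
    ((summable_geometric_of_lt_one (Real.sqrt_nonneg q) hr1).mul_left _), ?_⟩
  obtain ⟨xstar, hx⟩ := cauchySeq_tendsto_of_complete (cauchySeq_of_le_geometric _ _ hr1 hdist)
  have h1r : 0 < 1 - √q := by linarith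
  refine ⟨xstar, hx, √C / (1 - √q), by positivity, fun n => ?_⟩
  have h1 := dist_le_of_le_geometric_of_tendsto _ _ hr1 hdist hx n
  have h2 : q ^ ((n : ℝ) / 2) = √q ^ n := by
    rw [Real.sqrt_eq_rpow, ← Real.rpow_natCast, ← Real.rpow_mul hq0.le]
    congr 1
    ring
  rw [dist_eq_norm] at h1
  rw [h2, div_mul_eq_mul_div]
  exact h1

end LinearConvergence

/-! ### The proximal inequality -/

section ProxStep

variable {E : Type*} [NormedAddCommGroup E] [InnerProductSpace ℝ E]

/-- The variational inequality satisfied by a nearest point. -/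
theorem inner_le_of_isMaxOn_prox {S : Set E} {τ : ℝ} (hτ : 0 < τ) {z w q : E}
    (hmax : IsMaxOn (fun p => -(τ * ‖p - z - (1 / (2 * τ)) • w‖ ^ 2)) S q) {p : E} (hp : p ∈ S) :
    inner ℝ (w + (2 * τ) • (z - q)) (p - q) ≤ τ * ‖p - q‖ ^ 2 := by
  have h := hmax hp
  simp only [Set.mem_ofPred_eq, neg_le_neg_iff] at h
  -- Expanding the square about `q` cancels the term common to both sides.
  have hpq : p - z - (1 / (2 * τ)) • w = (p - q) + (q - z - (1 / (2 * τ)) • w) := by abel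
  rw [hpq, norm_add_sq_real] at h
  have h1 : (2 * τ) • (q - z - (1 / (2 * τ)) • w) = -(w + (2 * τ) • (z - q)) := by
    rw [smul_sub, smul_smul, mul_one_div_cancel (by positivity), one_smul, smul_sub, smul_sub]
    abel
  have h2 : 2 * τ * inner ℝ (p - q) (q - z - (1 / (2 * τ)) • w) =
      -inner ℝ (w + (2 * τ) • (z - q)) (p - q) := by
    rw [← real_inner_smul_right, h1, inner_neg_right, real_inner_comm]
  nlinarith

theorem isSymmetric_neg {a : E →L[ℝ] E} (ha : a.IsSymmetric) : (-a).IsSymmetric := by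
  intro x y
  simpa using ha x y

end ProxStep

/-! ### One step of the method: sufficient decrease and relative error -/

section Algorithm

variable {E : Type*} [NormedAddCommGroup E] [InnerProductSpace ℝ E]
  {a b : E →L[ℝ] E} {ι : Type*} {V : ι → Submodule ℝ E} {α β δ νbar τ ν : ℝ} {xprev x xnext : E}

theorem limitingSubdiff_inner_self_apply_subset [CompleteSpace E] {T : E →L[ℝ] E}
    (hT : T.IsSymmetric) (x : E) :
    limitingSubdiff (fun p => ((inner ℝ p (T p) : ℝ) : EReal)) x ⊆ {(2 : ℝ) • T x} :=
  limitingSubdiff_coe_subset (hasGradientAt_inner_self_apply hT) (T.continuous.const_smul _) x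

/-- A zero of a nonnegative quadratic form is a minimizer, so its gradient `2 T x` vanishes. Hence
the convention `w = 0` at a zero numerator agrees with the gradient formula. -/
theorem apply_eq_zero_of_inner_self_eq_zero [CompleteSpace E] {T : E →L[ℝ] E} (hT : T.IsSymmetric)
    (hT0 : ∀ x, 0 ≤ inner ℝ x (T x)) {x : E} (hx : inner ℝ x (T x) = 0) : T x = 0 := by
  have hmin : IsLocalMin (fun x => (inner ℝ x (T x) : ℝ)) x :=
    Eventually.of_forall fun y => hx.le.trans (hT0 y)
  have h := hmin.hasFDerivAt_eq_zero (hasGradientAt_inner_self_apply hT x).hasFDerivAt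
  simpa using h

/-- The search direction of the method is the gradient of the maximized quotient. -/
theorem searchDirection_eq_neg_rayleighGrad [CompleteSpace E] (ha : a.IsSymmetric)
    (ha0 : ∀ x, 0 ≤ inner ℝ x ((-a) x)) {y : ℝ} (hbx : 0 < inner ℝ x (b x))
    (hy : y = √(inner ℝ x ((-a) x)) / inner ℝ x (b x)) :
    (if 0 < inner ℝ x ((-a) x) then (y / √(inner ℝ x ((-a) x))) • (2 : ℝ) • (-a) x -
      (y ^ 2) • (2 : ℝ) • b x else 0) = -rayleighGrad a b x := by
  have hax : inner ℝ x ((-a) x) = -inner ℝ x (a x) := by simp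
  split_ifs with h
  · have hs : 0 < √(inner ℝ x ((-a) x)) := Real.sqrt_pos.2 h
    have h1 : y / √(inner ℝ x ((-a) x)) = 1 / inner ℝ x (b x) := by
      rw [hy]; field_simp
    have h2 : y ^ 2 = -inner ℝ x (a x) / inner ℝ x (b x) ^ 2 := by
      rw [hy, div_pow, Real.sq_sqrt h.le, hax]
    rw [h1, h2, rayleighGrad, rayleigh]
    simp only [neg_apply]
    module
  · have h0 : inner ℝ x ((-a) x) = 0 := le_antisymm (not_lt.1 h) (ha0 x)
    have h1 : a x = 0 := by
      have := apply_eq_zero_of_inner_self_eq_zero (isSymmetric_neg ha) ha0 h0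
      simpa using this
    simp [rayleighGrad, rayleigh, h1]

theorem le_of_isInertialProxStep (hα : 0 ≤ α) (hβ : 0 ≤ β)
    (hpos : ∀ x : E, x ≠ 0 → 0 < inner ℝ x (b x)) (hx : x ∈ unitUnion V)
    (hstep : IsInertialProxStep (fun p => inner ℝ p ((-a) p)) (fun p => inner ℝ p (b p))
      (unitUnion V) α β δ νbar τ ν xprev x xnext) : δ ≤ τ := by
  obtain ⟨u, -, v, -, y, z, w, hy, hτ, -⟩ := hstep
  have hbx : 0 < inner ℝ x (b x) := hpos x (ne_zero_of_mem_unitUnion hx)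
  have hy0 : 0 ≤ y := by rw [hy]; positivity
  have : 0 ≤ (2 * y * α + y ^ 2 * β) / 2 := by positivity
  linarith

/-- Sufficient decrease along one step of the method. -/
theorem rayleigh_add_le_of_isInertialProxStep
    (ha0 : ∀ x, 0 ≤ inner ℝ x ((-a) x)) (hpos : ∀ x : E, x ≠ 0 → 0 < inner ℝ x (b x))
    (hα : IsNumeratorConstant (fun p => inner ℝ p ((-a) p)) (unitUnion V) α)
    (hβ : IsDenominatorConstant (fun p => inner ℝ p (b p)) (unitUnion V) β)
    (hδ : 0 < δ) (hx : x ∈ unitUnion V)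
    (hstep : IsInertialProxStep (fun p => inner ℝ p ((-a) p)) (fun p => inner ℝ p (b p))
      (unitUnion V) α β δ νbar τ ν xprev x xnext) :
    rayleigh a b xnext + (δ - νbar) * ‖xnext - x‖ ^ 2 ≤
      rayleigh a b x + νbar * ‖x - xprev‖ ^ 2 := by
  have hδτ : δ ≤ τ := le_of_isInertialProxStep hα.1 hβ.1 hpos hx hstep
  have hτ0 : 0 < τ := hδ.trans_le hδτ
  obtain ⟨u, hu, v, hv, y, z, w, hy, hτ, hν0, hν, hz, hw, hxn, hmax⟩ := hstep
  beta_reduce at hu hv hy hw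
  have hbx : 0 < inner ℝ x (b x) := hpos x (ne_zero_of_mem_unitUnion hx)
  have hbxn : 0 < inner ℝ xnext (b xnext) := hpos xnext (ne_zero_of_mem_unitUnion hxn)
  have hτν : τ * ν ≤ νbar := by rwa [le_div_iff₀ hτ0, mul_comm] at hν
  have hprox := inner_le_of_isMaxOn_prox hτ0 hmax hx
  have hzx : z - xnext = ν • (x - xprev) - (xnext - x) := by rw [hz]; abel
  rw [hzx, ← neg_sub xnext x, inner_neg_right, norm_neg, inner_add_left, real_inner_smul_left,
    inner_sub_left, real_inner_smul_left, real_inner_self_eq_norm_sq] at hprox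
  set Δ := xnext - x with hΔ
  set d := x - xprev with hd
  -- Young's inequality splits the inertial cross term `2 τ ν ⟨d, Δ⟩`, with `τ ν ≤ νbar`.
  have hw1 : (τ - νbar) * ‖Δ‖ ^ 2 - νbar * ‖d‖ ^ 2 ≤ inner ℝ w Δ := by
    have h1 : 2 * inner ℝ d Δ ≤ ‖d‖ ^ 2 + ‖Δ‖ ^ 2 := by
      have := norm_sub_sq_real d Δ
      nlinarith [sq_nonneg ‖d - Δ‖]
    have h2 : τ * ν * (2 * inner ℝ d Δ) ≤ τ * ν * (‖d‖ ^ 2 + ‖Δ‖ ^ 2) := by gcongr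
    have h3 : τ * ν * (‖d‖ ^ 2 + ‖Δ‖ ^ 2) ≤ νbar * (‖d‖ ^ 2 + ‖Δ‖ ^ 2) := by gcongr
    nlinarith
  have hR : ∀ p, rayleigh a b p = -(inner ℝ p ((-a) p) / inner ℝ p (b p)) := fun p => by
    simp [rayleigh, neg_div]
  have hw2 : inner ℝ w Δ ≤ rayleigh a b x - rayleigh a b xnext +
      (2 * y * α + y ^ 2 * β) / 2 * ‖Δ‖ ^ 2 := by
    rw [hR, hR]
    by_cases hf : 0 < inner ℝ x ((-a) x)
    · rw [if_pos hf] at hw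
      have hα' := hα.2 x hx xnext hxn u hu hf
      have hβ' := hβ.2 x hx xnext hxn v hv
      simp only [real_inner_smul_left] at hα' hβ'
      rw [hw, inner_sub_left, real_inner_smul_left, real_inner_smul_left]
      rw [← hΔ] at hα' hβ'
      have hs : 0 < √(inner ℝ x ((-a) x)) := Real.sqrt_pos.2 hf
      have hy0 : 0 ≤ y := by rw [hy]; positivity
      have e1 := Real.sq_sqrt hf.le
      have e2 := Real.sq_sqrt (ha0 xnext)
      set s := √(inner ℝ x ((-a) x)) with hs_def
      set s' := √(inner ℝ xnext ((-a) xnext)) with hs'_def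
      rw [← e1, ← e2]
      have h1 : y / s * inner ℝ u Δ ≤ 2 * y * (s' - s + α / 2 * ‖Δ‖ ^ 2) := by
        have := mul_le_mul_of_nonneg_left hα' (by positivity : 0 ≤ 2 * y)
        refine le_trans (le_of_eq ?_) this
        field_simp
      have h2 := mul_le_mul_of_nonneg_left hβ' (sq_nonneg y)
      -- Quadratic transform of the ratio: `2 y s' - y² g' ≤ s'² / g'` for every `y`, with equality
      -- at `x` because `y = s / g` there.
      have h3 : 2 * y * s' - y ^ 2 * inner ℝ xnext (b xnext) ≤
          s' ^ 2 / inner ℝ xnext (b xnext) := by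
        rw [le_div_iff₀ hbxn]
        nlinarith [sq_nonneg (s' - y * inner ℝ xnext (b xnext))]
      have h4 : 2 * y * s - y ^ 2 * inner ℝ x (b x) = s ^ 2 / inner ℝ x (b x) := by
        rw [hy]
        field_simp
        ring
      nlinarith
    · have hf0 : inner ℝ x ((-a) x) = 0 := le_antisymm (not_lt.1 hf) (ha0 x)
      have hy0 : y = 0 := by rw [hy, hf0]; simp
      rw [if_neg hf] at hw
      have := div_nonneg (ha0 xnext) hbxn.le
      rw [hw, hy0, hf0]
      simpa using this
  nlinarith [mul_le_mul_of_nonneg_right hτ (sq_nonneg ‖Δ‖)]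

/-- The relative error condition: a small Fréchet subgradient at the next iterate. -/
theorem exists_mem_frechetSubdiff_of_isInertialProxStep [CompleteSpace E]
    (ha : a.IsSymmetric) (hb : b.IsSymmetric)
    (ha0 : ∀ x, 0 ≤ inner ℝ x ((-a) x)) (hpos : ∀ x : E, x ≠ 0 → 0 < inner ℝ x (b x))
    {K : ℝ} (hK : ∀ x y : E, ‖x‖ = 1 → ‖y‖ = 1 →
      ‖rayleighGrad a b x - rayleighGrad a b y‖ ≤ K * ‖x - y‖)
    (hτ0 : 0 < τ) (hx : x ∈ unitUnion V)
    (hstep : IsInertialProxStep (fun p => inner ℝ p ((-a) p)) (fun p => inner ℝ p (b p))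
      (unitUnion V) α β δ νbar τ ν xprev x xnext) :
    ∃ ξ ∈ frechetSubdiff (rayleighOn a b V) xnext,
      ‖ξ‖ ≤ (K + 2 * τ) * ‖xnext - x‖ + 2 * νbar * ‖x - xprev‖ := by
  obtain ⟨u, hu, v, hv, y, z, w, hy, hτ, hν0, hν, hz, hw, hxn, hmax⟩ := hstep
  beta_reduce at hu hv hy hw
  have hbx : 0 < inner ℝ x (b x) := hpos x (ne_zero_of_mem_unitUnion hx)
  have hbxn : 0 < inner ℝ xnext (b xnext) := hpos xnext (ne_zero_of_mem_unitUnion hxn)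
  have hτν : τ * ν ≤ νbar := by rwa [le_div_iff₀ hτ0, mul_comm] at hν
  have hu' : u = (2 : ℝ) • (-a) x :=
    limitingSubdiff_inner_self_apply_subset (isSymmetric_neg ha) x hu
  have hv' : v = (2 : ℝ) • b x := limitingSubdiff_inner_self_apply_subset hb x hv
  have hw' : w = -rayleighGrad a b x := by
    rw [hw, hu', hv']
    exact searchDirection_eq_neg_rayleighGrad ha ha0 hbx hy
  -- The bracket is a proximal normal to the constraint set at `xnext`, so adding it to the gradient
  -- gives a Fréchet subgradient. As `w` is minus the gradient at `x`, the sum is small by the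
  -- Lipschitz bound.
  refine ⟨rayleighGrad a b xnext + (w + (2 * τ) • (z - xnext)), ?_, ?_⟩
  · refine mem_frechetSubdiff_of_eventually_le (rayleighOn_of_mem hxn) fun ε hε => ?_
    have hgrad := (hasGradientAt_rayleigh ha hb hbxn.ne').hasFDerivAt.isLittleO.def (half_pos hε)
    -- On this ball the quadratic error `τ ‖p - xnext‖²` uses half of `ε`; differentiability uses
    -- the other half.
    have hball : ∀ᶠ p in 𝓝 xnext, ‖p - xnext‖ < ε / (2 * τ) := by
      filter_upwards [Metric.ball_mem_nhds xnext (by positivity : 0 < ε / (2 * τ))] with p hp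
      rwa [Metric.mem_ball, dist_eq_norm] at hp
    filter_upwards [hgrad, hball] with p hp1 hp2
    by_cases hpS : p ∈ unitUnion V
    swap
    · rw [rayleighOn_of_notMem hpS]; exact le_top
    rw [rayleighOn_of_mem hpS, EReal.coe_le_coe_iff, inner_add_left]
    have h1 := inner_le_of_isMaxOn_prox hτ0 hmax hpS
    rw [InnerProductSpace.toDual_apply_apply, Real.norm_eq_abs] at hp1
    have h2 := (abs_le.1 hp1).1
    have h3 : τ * ‖p - xnext‖ ^ 2 ≤ ε / 2 * ‖p - xnext‖ := by
      rw [lt_div_iff₀ (by positivity)] at hp2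
      nlinarith [norm_nonneg (p - xnext)]
    linarith
  · have hzx : z - xnext = ν • (x - xprev) - (xnext - x) := by rw [hz]; abel
    have e : rayleighGrad a b xnext + (w + (2 * τ) • (z - xnext)) =
        (rayleighGrad a b xnext - rayleighGrad a b x) +
          ((2 * τ * ν) • (x - xprev) - (2 * τ) • (xnext - x)) := by
      rw [hw', hzx, smul_sub, smul_smul]
      abel
    rw [e]
    have h1 := hK xnext x hxn.1 hx.1
    have h2 := norm_add_le (rayleighGrad a b xnext - rayleighGrad a b x)
      ((2 * τ * ν) • (x - xprev) - (2 * τ) • (xnext - x))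
    have h3 := norm_sub_le ((2 * τ * ν) • (x - xprev)) ((2 * τ) • (xnext - x))
    rw [norm_smul, norm_smul, Real.norm_of_nonneg (by positivity),
      Real.norm_of_nonneg (by positivity)] at h3
    have h4 := mul_le_mul_of_nonneg_right hτν (norm_nonneg (x - xprev))
    linarith

end Algorithm

/-! ### Linear convergence of the method -/

section Convergence

variable {E : Type*} [NormedAddCommGroup E] [InnerProductSpace ℝ E] [FiniteDimensional ℝ E]
  {a b : E →L[ℝ] E} {ι : Type*} [Finite ι] {V : ι → Submodule ℝ E}

theorem exists_forall_le_rayleigh (hpos : ∀ x : E, x ≠ 0 → 0 < inner ℝ x (b x)) :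
    ∃ m : ℝ, ∀ x : E, ‖x‖ = 1 → m ≤ rayleigh a b x := by
  have hcont : ContinuousOn (rayleigh a b) (Metric.sphere (0 : E) 1) := fun x hx =>
    (continuousAt_rayleigh (hpos x fun h => by simp [h] at hx).ne').continuousWithinAt
  obtain ⟨m, hm⟩ := (isCompact_sphere (0 : E) 1).bddBelow_image hcont
  exact ⟨m, fun x hx => hm ⟨x, by simpa using hx, rfl⟩⟩

/-- Linear convergence of the inertial proximal subgradient method for a Rayleigh quotient on the
unit vectors of a finite union of subspaces. -/
theorem linear_convergence_of_isInertialProxSequence (ha : a.IsSymmetric) (hb : b.IsSymmetric)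
    (ha0 : ∀ x, 0 ≤ inner ℝ x ((-a) x)) (hpos : ∀ x : E, x ≠ 0 → 0 < inner ℝ x (b x))
    {α β δ νbar : ℝ} {τ ν : ℕ → ℝ} {x : ℕ → E}
    (hα : IsNumeratorConstant (fun p => inner ℝ p ((-a) p)) (unitUnion V) α)
    (hβ : IsDenominatorConstant (fun p => inner ℝ p (b p)) (unitUnion V) β)
    (hseq : IsInertialProxSequence (fun p => inner ℝ p ((-a) p)) (fun p => inner ℝ p (b p))
      (unitUnion V) α β δ νbar τ ν x) (hτ : BddAbove (Set.range τ)) :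
    Summable (fun n => ‖x (n + 1) - x n‖) ∧
    ∃ xstar ∈ unitUnion V, Tendsto x atTop (𝓝 xstar) ∧
      0 ∈ limitingSubdiff (rayleighOn a b V) xstar ∧
      ∃ γ q : ℝ, 0 < γ ∧ 0 < q ∧ q < 1 ∧ ∀ n : ℕ, ‖x n - xstar‖ ≤ γ * q ^ ((n : ℝ) / 2) ∧
        |rayleigh a b (x n) - rayleigh a b xstar| ≤ γ * q ^ n := by
  obtain ⟨hδ, hν0, hν, hx0, hstep⟩ := hseq
  have hS : ∀ n, x n ∈ unitUnion V := by
    rintro (_ | n)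
    · exact hx0
    · obtain ⟨u, -, v, -, y, z, w, -, -, -, -, -, -, h, -⟩ := hstep n
      exact h
  have hδτ : ∀ n, δ ≤ τ n := fun n => le_of_isInertialProxStep hα.1 hβ.1 hpos (hS n) (hstep n)
  obtain ⟨T, hT⟩ := hτ
  have hτT : ∀ n, τ n ≤ T := fun n => hT ⟨n, rfl⟩
  obtain ⟨K, hK0, hK⟩ := exists_lipschitz_rayleighGrad (a := a) hpos
  -- Truncated subtraction gives `D 0 = 0`, in accordance with `x (-1) = x 0`.
  set D : ℕ → ℝ := fun n => ‖x n - x (n - 1)‖ ^ 2 with hD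
  have hD0 : ∀ n, 0 ≤ D n := fun n => sq_nonneg _
  have hDs : ∀ n, D (n + 1) = ‖x (n + 1) - x n‖ ^ 2 := fun n => rfl
  -- The weight `δ / 2` leaves the same surplus `δ / 2 - νbar` on both `D (n + 1)` and `D n`.
  set H : ℕ → ℝ := fun n => rayleigh a b (x n) + δ / 2 * D n with hH
  set κ := δ / 2 - νbar with hκ
  have hκ0 : 0 < κ := by linarith
  have hdec : ∀ n, H (n + 1) + κ * (D (n + 1) + D n) ≤ H n := by
    intro n
    have := rayleigh_add_le_of_isInertialProxStep ha0 hpos hα hβ hδ (hS n) (hstep n)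
    rw [← hDs, show ‖x n - x (n - 1)‖ ^ 2 = D n from rfl] at this
    simp only [hH, hκ]
    linarith
  have hanti : Antitone H := antitone_nat_of_succ_le fun n => by
    have := mul_nonneg hκ0.le (add_nonneg (hD0 (n + 1)) (hD0 n))
    linarith [hdec n]
  obtain ⟨m, hm⟩ := exists_forall_le_rayleigh (a := a) hpos
  have hbdd : BddBelow (Set.range H) := by
    refine ⟨m, ?_⟩
    rintro _ ⟨n, rfl⟩
    have := mul_nonneg (half_pos hδ).le (hD0 n)
    have := hm (x n) (hS n).1
    simp only [hH]
    linarith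
  -- The level for the quadratic bound: since `D` tends to 0, it is also the limit of the quotients.
  set μ := ⨅ n, H n with hμ
  have hHμ : Tendsto H atTop (𝓝 μ) := tendsto_atTop_ciInf hanti hbdd
  have hμH : ∀ n, μ ≤ H n := fun n => ciInf_le hbdd n
  have hDlim : Tendsto D atTop (𝓝 0) := by
    have h1 : Tendsto (fun n => κ⁻¹ * (H n - H (n + 1))) atTop (𝓝 0) := by
      have := (hHμ.sub (hHμ.comp (tendsto_add_atTop_nat 1))).const_mul κ⁻¹
      simpa using this
    refine squeeze_zero hD0 (fun n => ?_) h1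
    rw [inv_mul_eq_div, le_div_iff₀ hκ0]
    have := mul_nonneg hκ0.le (hD0 (n + 1))
    linarith [hdec n]
  have hRlim : Tendsto (fun n => rayleigh a b (x n)) atTop (𝓝 μ) := by
    have := hHμ.sub (hDlim.const_mul (δ / 2))
    simpa [hH] using this
  set L := K + 2 * T + 2 * νbar with hL
  have hT0 : 0 < T := hδ.trans_le ((hδτ 0).trans (hτT 0))
  have hL0 : 0 < L := by positivity
  have hξ : ∀ n, ∃ ξ ∈ frechetSubdiff (rayleighOn a b V) (x (n + 1)),
      ‖ξ‖ ^ 2 ≤ 2 * L ^ 2 * (D (n + 1) + D n) := by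
    intro n
    obtain ⟨ξ, hξ, hle⟩ := exists_mem_frechetSubdiff_of_isInertialProxStep ha hb ha0 hpos hK
      (hδ.trans_le (hδτ n)) (hS n) (hstep n)
    refine ⟨ξ, hξ, ?_⟩
    set s := ‖x (n + 1) - x n‖
    set t := ‖x n - x (n - 1)‖
    have h1 : ‖ξ‖ ≤ L * (s + t) := by
      have h2 : (K + 2 * τ n) * s ≤ L * s := by
        gcongr
        linarith [hτT n]
      have h3 : 2 * νbar * t ≤ L * t := by
        gcongr
        linarith
      linarith
    calc ‖ξ‖ ^ 2 ≤ (L * (s + t)) ^ 2 := by gcongr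
      _ = L ^ 2 * (s + t) ^ 2 := by ring
      _ ≤ L ^ 2 * (2 * (s ^ 2 + t ^ 2)) := by gcongr; nlinarith [sq_nonneg (s - t)]
      _ = 2 * L ^ 2 * (s ^ 2 + t ^ 2) := by ring
  choose ξ hξmem hξle using hξ
  obtain ⟨ε, hε, c, hc, hKL⟩ :=
    exists_mul_abs_sub_le_norm_sq_of_mem_frechetSubdiff ha hb hpos V μ
  have herr : ∀ᶠ n in atTop, H (n + 1) - μ ≤ (2 * L ^ 2 / c + δ / 2) * (D (n + 1) + D n) := by
    have := (hRlim.comp (tendsto_add_atTop_nat 1)).eventually (Metric.ball_mem_nhds μ hε)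
    filter_upwards [this] with n hn
    have h1 := (hKL _ _ (hξmem n) hn).trans (hξle n)
    have h2 : |rayleigh a b (x (n + 1)) - μ| ≤ 2 * L ^ 2 / c * (D (n + 1) + D n) := by
      rw [div_mul_eq_mul_div, le_div_iff₀ hc, mul_comm]
      exact h1
    have h3 := mul_nonneg (half_pos hδ).le (hD0 n)
    have h4 := le_abs_self (rayleigh a b (x (n + 1)) - μ)
    simp only [hH]
    linarith
  obtain ⟨C, q, hC, hq0, hq1, hdecay⟩ := exists_le_mul_pow_of_decrease (h := fun n => H n - μ)
    hκ0 (by positivity) (fun n => sub_nonneg.2 (hμH n)) hD0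
    (fun n => by linarith [hdec n]) herr
  obtain ⟨hsum, xstar, hxlim, γ, hγ, hxγ⟩ := exists_tendsto_of_norm_sub_sq_le (x := x) hC hq0 hq1
    fun n => by
      rw [← hDs]
      refine (hdecay (n + 1)).2.trans ?_
      gcongr C * ?_
      exact pow_le_pow_of_le_one hq0.le hq1.le (Nat.le_succ n)
  have hxS : xstar ∈ unitUnion V := isClosed_unitUnion.mem_of_tendsto hxlim (.of_forall hS)
  have hcont : ContinuousAt (rayleigh a b) xstar :=
    continuousAt_rayleigh (hpos xstar (ne_zero_of_mem_unitUnion hxS)).ne'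
  have hRx : rayleigh a b xstar = μ := tendsto_nhds_unique (hcont.tendsto.comp hxlim) hRlim
  refine ⟨hsum, xstar, hxS, hxlim, ⟨?_, ?_, fun n => x (n + 1), ξ, ?_, ?_, ?_, hξmem⟩, ?_⟩
  · rw [rayleighOn_of_mem hxS]; exact EReal.coe_ne_top _
  · rw [rayleighOn_of_mem hxS]; exact EReal.coe_ne_bot _
  · exact hxlim.comp (tendsto_add_atTop_nat 1)
  · simp only [rayleighOn_of_mem hxS, rayleighOn_of_mem (hS _)]
    rw [hRx]
    exact (continuous_coe_real_ereal.tendsto μ).comp (hRlim.comp (tendsto_add_atTop_nat 1))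
  · have h1 : Tendsto (fun n => 2 * L ^ 2 * (D (n + 1) + D n)) atTop (𝓝 0) := by
      have := ((hDlim.comp (tendsto_add_atTop_nat 1)).add hDlim).const_mul (2 * L ^ 2)
      simpa using this
    have h2 := (squeeze_zero (fun n => sq_nonneg _) hξle h1).sqrt
    simp only [Real.sqrt_sq (norm_nonneg _), Real.sqrt_zero] at h2
    exact tendsto_zero_iff_norm_tendsto_zero.2 h2
  -- The value error is at most `(H n - μ) + (δ / 2) D n`, hence at most `C (1 + δ / 2) q ^ n`.
  · refine ⟨γ + C * (1 + δ / 2), q, by positivity, hq0, hq1, fun n => ⟨?_, ?_⟩⟩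
    · refine (hxγ n).trans ?_
      gcongr
      have : 0 < C * (1 + δ / 2) := by positivity
      linarith
    · rw [hRx]
      have h1 := (hdecay n).1
      have h2 := mul_le_mul_of_nonneg_left (hdecay n).2 (half_pos hδ).le
      have h3 : 0 < γ * q ^ n := by positivity
      have h4 := mul_nonneg (half_pos hδ).le (hD0 n)
      have h5 := hμH n
      simp only [hH] at h1 h5
      have h6 : 0 < C * q ^ n := by positivity
      rw [abs_le]
      constructor <;> nlinarith

end Convergence

/-! ### Sparse vectors as a union of coordinate subspaces; matrices as operators -/

section Sparse

variable {d : ℕ}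

/-- The coordinate subspace of the vectors supported in `I`. -/
def coordSubspace (I : Finset (Fin d)) : Submodule ℝ (EuclideanSpace ℝ (Fin d)) where
  carrier := {x | ∀ i ∉ I, x i = 0}
  add_mem' hx hy i hi := by simp [hx i hi, hy i hi]
  zero_mem' i _ := rfl
  smul_mem' c x hx i hi := by simp [hx i hi]

/-- The coordinate subspaces of dimension at most `r`. -/
def sparseSubspaces (d r : ℕ) (I : {I : Finset (Fin d) // I.card ≤ r}) :
    Submodule ℝ (EuclideanSpace ℝ (Fin d)) := coordSubspace I.1

/-- A vector lies in the coordinate subspace of its own support. This brings the sparsity constraint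
under the results on finite unions of subspaces. -/
theorem unitUnion_sparseSubspaces (d r : ℕ) :
    unitUnion (sparseSubspaces d r) = unitSphere d ∩ sparseSet d r := by
  ext x
  simp only [unitUnion, unitSphere, sparseSet, Set.mem_inter_iff, Set.mem_ofPred_eq]
  refine and_congr_right fun _ => ⟨?_, fun h => ?_⟩
  · rintro ⟨⟨I, hI⟩, hx⟩
    refine le_trans (Finset.card_le_card fun i hi => ?_) hI
    by_contra h
    exact (Finset.mem_filter.1 hi).2 (hx i h)
  · refine ⟨⟨Finset.univ.filter fun i => x i ≠ 0, h⟩, fun i hi => ?_⟩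
    by_contra h0
    exact hi (Finset.mem_filter.2 ⟨Finset.mem_univ i, h0⟩)

theorem nonempty_unitUnion_sparseSubspaces {d r : ℕ} (hd : 0 < d) (hr : 0 < r) :
    (unitUnion (sparseSubspaces d r)).Nonempty := by
  refine ⟨EuclideanSpace.single ⟨0, hd⟩ 1, by simp,
    ⟨{⟨0, hd⟩}, by simpa [Nat.one_le_iff_ne_zero] using hr.ne'⟩, fun i hi => ?_⟩
  simpa using hi

/-- The operator on Euclidean space defined by a matrix. -/
abbrev matrixOp (M : Matrix (Fin d) (Fin d) ℝ) :
    EuclideanSpace ℝ (Fin d) →L[ℝ] EuclideanSpace ℝ (Fin d) :=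
  Matrix.toEuclideanCLM (n := Fin d) (𝕜 := ℝ) M

theorem quadForm_eq_inner (M : Matrix (Fin d) (Fin d) ℝ) (x : EuclideanSpace ℝ (Fin d)) :
    quadForm M x = inner ℝ x (matrixOp M x) := by
  rw [quadForm, EuclideanSpace.inner_eq_star_dotProduct, star_trivial, dotProduct_comm]
  rfl

theorem isSymmetric_matrixOp {M : Matrix (Fin d) (Fin d) ℝ} (hM : M.IsSymm) :
    (matrixOp M).IsSymmetric := by
  rw [← ContinuousLinearMap.isSelfAdjoint_iff_isSymmetric]
  have : IsSelfAdjoint M := by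
    rw [isSelfAdjoint_iff, Matrix.star_eq_conjTranspose,
      Matrix.conjTranspose_eq_transpose_of_trivial]
    exact hM
  exact this.map _

theorem matrixOp_neg (M : Matrix (Fin d) (Fin d) ℝ) : matrixOp (-M) = -matrixOp M := map_neg _ M

theorem inner_matrixOp_pos {B : Matrix (Fin d) (Fin d) ℝ} (hB : B.PosDef)
    (x : EuclideanSpace ℝ (Fin d)) (hx : x ≠ 0) : 0 < inner ℝ x (matrixOp B x) := by
  rw [← quadForm_eq_inner, quadForm]
  simpa using hB.dotProduct_mulVec_pos (x := x.ofLp) (by simpa using hx)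

theorem inner_matrixOp_nonneg {M : Matrix (Fin d) (Fin d) ℝ} (hM : M.PosSemidef)
    (x : EuclideanSpace ℝ (Fin d)) : 0 ≤ inner ℝ x (matrixOp M x) := by
  rw [← quadForm_eq_inner, quadForm]
  simpa using hM.dotProduct_mulVec_nonneg x.ofLp

theorem quadForm_neg_eq (M : Matrix (Fin d) (Fin d) ℝ) :
    quadForm (-M) = fun x => inner ℝ x ((-matrixOp M) x) := by
  funext x
  rw [quadForm_eq_inner, matrixOp_neg]

theorem Phi_eq_rayleighOn (A B : Matrix (Fin d) (Fin d) ℝ) (r : ℕ) :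
    Phi A B r = rayleighOn (matrixOp A) (matrixOp B) (sparseSubspaces d r) := by
  funext x
  rw [Phi, rayleighOn, unitUnion_sparseSubspaces, quadForm_eq_inner, quadForm_eq_inner, rayleigh]

theorem meritPhi_eq_meritOn (A B : Matrix (Fin d) (Fin d) ℝ) (r : ℕ) (ρ : ℝ) :
    meritPhi A B r ρ = meritOn (matrixOp A) (matrixOp B) (sparseSubspaces d r) ρ := by
  funext z
  rw [meritPhi, meritOn, Phi_eq_rayleighOn]

end Sparse

end SparseGEP

end

theorem theorem3p5 (d r : ℕ) (hd : 0 < d) (hr : 0 < r) (A B : Matrix (Fin d) (Fin d) ℝ)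
    (hA : A.IsSymm) (hB : B.PosDef) :
    -- `Φ` is a KL function with exponent `1/2`
    SparseGEP.IsKLFunctionWithExponent (SparseGEP.Phi A B r) (1 / 2) ∧
    -- the merit function has the KL property with exponent `1/2` on the diagonal
    (∀ ρ : ℝ, 0 ≤ ρ → ∀ xbar ∈ SparseGEP.subdiffDomain (SparseGEP.Phi A B r),
      SparseGEP.HasKLPropertyWithExponent (SparseGEP.meritPhi A B r ρ)
        (WithLp.toLp 2 (xbar, xbar)) (1 / 2)) ∧
    -- linear convergence of the method for maximizing `xᵀ(-A)x / xᵀBx` over `Λ ∩ C_r`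
    ((-A).PosSemidef →
      ∀ (α β δ νbar : ℝ) (τ ν : ℕ → ℝ) (x : ℕ → EuclideanSpace ℝ (Fin d)),
        SparseGEP.IsNumeratorConstant (SparseGEP.quadForm (-A))
          (SparseGEP.unitSphere d ∩ SparseGEP.sparseSet d r) α →
        SparseGEP.IsDenominatorConstant (SparseGEP.quadForm B)
          (SparseGEP.unitSphere d ∩ SparseGEP.sparseSet d r) β →
        SparseGEP.IsInertialProxSequence (SparseGEP.quadForm (-A)) (SparseGEP.quadForm B)
          (SparseGEP.unitSphere d ∩ SparseGEP.sparseSet d r) α β δ νbar τ ν x →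
        BddAbove (Set.range τ) →
        Summable (fun n => ‖x (n + 1) - x n‖) ∧
        ∃ xstar ∈ SparseGEP.unitSphere d ∩ SparseGEP.sparseSet d r,
          Filter.Tendsto x Filter.atTop (nhds xstar) ∧
          0 ∈ SparseGEP.limitingSubdiff (SparseGEP.Phi A B r) xstar ∧
          ∃ γ q : ℝ, 0 < γ ∧ 0 < q ∧ q < 1 ∧ ∀ n : ℕ,
            ‖x n - xstar‖ ≤ γ * q ^ ((n : ℝ) / 2) ∧
            |SparseGEP.quadForm (-A) (x n) / SparseGEP.quadForm B (x n) -
              SparseGEP.quadForm (-A) xstar / SparseGEP.quadForm B xstar| ≤ γ * q ^ n) := by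
  have ha := SparseGEP.isSymmetric_matrixOp hA
  have hb := SparseGEP.isSymmetric_matrixOp (M := B) hB.isHermitian
  have hpos := SparseGEP.inner_matrixOp_pos hB
  simp only [SparseGEP.meritPhi_eq_meritOn, SparseGEP.Phi_eq_rayleighOn]
  refine ⟨⟨⟨SparseGEP.isProper_rayleighOn (SparseGEP.nonempty_unitUnion_sparseSubspaces hd hr),
    SparseGEP.lowerSemicontinuous_rayleighOn hpos, fun xbar hx => ?_⟩,
    fun xbar hx => SparseGEP.hasKLPropertyWithExponent_rayleighOn ha hb hpos hx⟩,
    fun ρ hρ xbar hx => SparseGEP.hasKLPropertyWithExponent_meritOn ha hb hpos hρ hx, ?_⟩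
  · obtain ⟨-, -, γ, -, h⟩ := SparseGEP.hasKLPropertyWithExponent_rayleighOn ha hb hpos hx
    exact ⟨_, h⟩
  intro hA0 α β δ νbar τ ν x
  have ha0 := SparseGEP.inner_matrixOp_nonneg hA0
  rw [SparseGEP.matrixOp_neg] at ha0
  have hg : SparseGEP.quadForm B = fun x => inner ℝ x (SparseGEP.matrixOp B x) :=
    funext (SparseGEP.quadForm_eq_inner B)
  rw [SparseGEP.quadForm_neg_eq, hg, ← SparseGEP.unitUnion_sparseSubspaces]
  intro hα hβ hseq hτ
  obtain ⟨hsum, xstar, hxS, hlim, hcrit, γ, q, hγ, hq0, hq1, hrate⟩ :=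
    SparseGEP.linear_convergence_of_isInertialProxSequence ha hb ha0 hpos hα hβ hseq hτ
  refine ⟨hsum, xstar, hxS, hlim, hcrit, γ, q, hγ, hq0, hq1, fun n => ⟨(hrate n).1, ?_⟩⟩
  -- The maximized quotient is minus the minimized one, so the rate for the values carries over.
  have hneg : ∀ p, inner ℝ p ((-SparseGEP.matrixOp A) p) / inner ℝ p (SparseGEP.matrixOp B p) =
      -SparseGEP.rayleigh (SparseGEP.matrixOp A) (SparseGEP.matrixOp B) p := fun p => by
    rw [SparseGEP.rayleigh, neg_apply, inner_neg_right, neg_div]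
  simp only [hneg]
  rw [neg_sub_neg, abs_sub_comm]
  exact (hrate n).2
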